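/- Let $\mathcal P$ be the set of all primes and let $\mathcal P_2=\mathcal P\cup\{p_1p_2 : p_1,p_2\in\mathcal P\}$ be the set of integers that are a prime or a product of two (not necessarily distinct) primes. For a set $A$ of positive integers and a real number $x$ put $A(x)=|\{a\in A : 1\le a\le x\}|$. Then the sumset $$2^{\mathcal P}+\mathcal P_2=\{2^p+q : p\in\mathcal P,\ q\in\mathcal P_2\}$$ has a positive lower density, i.e., there exists a constant $C>0$ such that $(2^{\mathcal P}+\mathcal P_2)(x)>Cx$ for all sufficiently large $x$. -/

import Mathlib

/-- The counting function `A(x) = |{1 ≤ a ≤ x : a ∈ A}|` of a set `A` of natural numbers,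
for a real argument `x`. The set counted is always finite. -/
noncomputable def countingFunction (A : Set ℕ) (x : ℝ) : ℕ :=
  {a : ℕ | 1 ≤ a ∧ (a : ℝ) ≤ x ∧ a ∈ A}.ncard

/-- `A` has a positive lower (asymptotic) density: there is a positive constant `C` such that
`A(x) > C x` for all sufficiently large real `x`. -/
def HasPositiveLowerDensity (A : Set ℕ) : Prop :=
  ∃ C : ℝ, 0 < C ∧ ∃ x₀ : ℝ, ∀ x : ℝ, x₀ ≤ x → C * x < (countingFunction A x : ℝ)

/-- The set of all integers that are a prime or a product of two primes, not necessarily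
distinct. -/
def primeOrProductOfTwoPrimes : Set ℕ :=
  {q : ℕ | q.Prime ∨ ∃ p₁ p₂ : ℕ, p₁.Prime ∧ p₂.Prime ∧ q = p₁ * p₂}

/-! The argument is Romanoff's second moment method. Take primes `p ≤ L` with `L` about `log₂ N`,
and products `l q` with `l ≤ z = ⌊N^(1/4)⌋ < q` prime and `2 l q ≤ N`. Put `W = ∑ 1/l` over primes
`l ≤ z`. Chebyshev bounds give `M ≫ (L / log L) (N / log N) W ≫ N t` triples `(p, l, q)`, where `t =
W / log L`. Products of two primes are what make this large enough: with `q` prime alone there are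
only about `N / log log N` pairs, and the missing factor is `W ≫ log log N`, so that `t ≥ 1/4`.

By Cauchy-Schwarz the number of values `2^p + l q` is at least `M²` divided by the number of
collisions. If `p = p'`, unique factorization together with `l, l' ≤ z < q, q'` leaves only the `M`
trivial collisions. If `p ≠ p'`, put `h = 2^p - 2^p'`; the solutions of `l q + h = l' q'` are prime
values of two linear forms, and Selberg's sieve bounds their number by a constant times `N / log² N
· 1/(l l') · F(h)²` (with `1/l` if `l = l'`), where `F` is `eulerFactor`. The sum over `l, l'` gives
`W² + W`.

For the sum of `F(h)²` over `p ≠ p'`, sort by `d = |p - p'|`. The sieve again bounds the prime pairs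
with difference `d`, at the cost of `F(d)²`, and what remains is the sum of `F(2^d - 1)² F(d)²` over
`d ≤ L`. It is `O(L)` because the fourth moments of `F(d)` and of `F(2^d - 1)` are bounded on
average, the second by Romanoff's lemma (`exists_sum_eulerFactor_two_pow_sub_one_le`). The
collisions are thus `≪ M + N t²`, and since `M ≫ N t` and `t ≥ 1/4` the number of values is `≫ N`.
-/

section

open Finset ArithmeticFunction
open scoped ArithmeticFunction.Moebius

/-! ### Selberg's upper bound sieve with a crude remainder. -/

namespace BoundingSieve

variable (s : BoundingSieve)

/-- The sum of the Selberg terms up to `D`. -/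
noncomputable def selbergSum (D : ℕ) : ℝ :=
  ∑ l ∈ s.prodPrimes.divisors with l ≤ D, s.selbergTerms l

/-- The optimal weights of the Selberg sieve of level `D ^ 2`. -/
noncomputable def optimalWeights (D : ℕ) (d : ℕ) : ℝ :=
  (s.nu d)⁻¹ * (μ d / s.selbergSum D *
    ∑ l ∈ s.prodPrimes.divisors with l ≤ D ∧ d ∣ l, s.selbergTerms l)

theorem selbergSum_pos {D : ℕ} (hD : 1 ≤ D) : 0 < s.selbergSum D := by
  refine sum_pos (fun l hl => selbergTerms_pos ?_) ⟨1, ?_⟩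
  · simp only [mem_filter, Nat.mem_divisors] at hl
    exact hl.1.1
  · simp [prodPrimes_ne_zero, hD]

theorem optimalWeights_one {D : ℕ} (hD : 1 ≤ D) : s.optimalWeights D 1 = 1 := by
  have h := (s.selbergSum_pos hD).ne'
  have : ∑ l ∈ s.prodPrimes.divisors with l ≤ D ∧ 1 ∣ l, s.selbergTerms l = s.selbergSum D := by
    simp [selbergSum]
  rw [optimalWeights, this, s.nu_mult.map_one]
  simp [h]

theorem optimalWeights_eq_zero {D d : ℕ} (hd : D < d) : s.optimalWeights D d = 0 := by
  rw [optimalWeights, filter_eq_empty_iff.2, sum_empty, mul_zero, mul_zero]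
  rintro l hl ⟨h1, h2⟩
  have := Nat.le_of_dvd (Nat.pos_of_mem_divisors hl) h2
  omega

theorem abs_optimalWeights_le {D d : ℕ} (hd : d ∣ s.prodPrimes) (hD : 1 ≤ D) :
    |s.optimalWeights D d| ≤ (s.nu d)⁻¹ := by
  have hnu := nu_pos_of_dvd_prodPrimes hd
  have hS := s.selbergSum_pos hD
  have hpos : ∀ l ∈ s.prodPrimes.divisors, 0 ≤ s.selbergTerms l := fun l hl =>
    (selbergTerms_pos (Nat.dvd_of_mem_divisors hl)).le
  have h0 : 0 ≤ ∑ l ∈ s.prodPrimes.divisors with l ≤ D ∧ d ∣ l, s.selbergTerms l :=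
    sum_nonneg fun l hl => hpos l (mem_filter.1 hl).1
  have h1 : ∑ l ∈ s.prodPrimes.divisors with l ≤ D ∧ d ∣ l, s.selbergTerms l ≤ s.selbergSum D := by
    refine sum_le_sum_of_subset_of_nonneg (fun l hl => ?_)
      fun l hl _ => hpos l (mem_filter.1 hl).1
    simp only [mem_filter] at hl ⊢
    exact ⟨hl.1, hl.2.1⟩
  have hmu : |(μ d : ℝ)| ≤ 1 := by exact_mod_cast abs_moebius_le_one
  rw [optimalWeights, abs_mul, abs_mul, abs_div, abs_of_pos hS, abs_of_nonneg h0,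
    abs_of_pos (inv_pos.2 hnu)]
  refine mul_le_of_le_one_right (inv_pos.2 hnu).le ?_
  rw [div_mul_eq_mul_div, div_le_one hS]
  exact (mul_le_of_le_one_left h0 hmu).trans h1

/-- The sum of `μ` over the multiples of `l` dividing a squarefree `m`. -/
theorem sum_moebius_of_dvd {P l m : ℕ} (hP : Squarefree P) (hm : m ∣ P) (hl : l ∣ m) :
    ∑ d ∈ P.divisors with l ∣ d ∧ d ∣ m, (μ d : ℝ) = if l = m then (μ l : ℝ) else 0 := by
  have hP0 := hP.ne_zero
  obtain ⟨k, rfl⟩ := hl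
  have hsq : Squarefree (l * k) := hP.squarefree_of_dvd hm
  have hl0 : l ≠ 0 := by rintro rfl; simp at hsq
  have hk0 : k ≠ 0 := by rintro rfl; simp at hsq
  have hcop : l.Coprime k := (Nat.squarefree_mul_iff.1 hsq).1
  -- Write `d = l e`: then `e ∣ m / l` is coprime to `l`, so `μ(l)` factors out and the sum of
  -- `μ(e)` vanishes unless `m = l`.
  have hset : {d ∈ P.divisors | l ∣ d ∧ d ∣ l * k} = k.divisors.image (l * ·) := by
    ext d
    simp only [mem_filter, Nat.mem_divisors, mem_image]
    constructor
    · rintro ⟨-, ⟨e, rfl⟩, h⟩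
      exact ⟨e, ⟨Nat.dvd_of_mul_dvd_mul_left (Nat.pos_of_ne_zero hl0) h, hk0⟩, rfl⟩
    · rintro ⟨e, ⟨he, -⟩, rfl⟩
      exact ⟨⟨(Nat.mul_dvd_mul_left l he).trans hm, hP0⟩, dvd_mul_right _ _,
        Nat.mul_dvd_mul_left l he⟩
  rw [hset, sum_image (fun a _ b _ h => Nat.eq_of_mul_eq_mul_left (Nat.pos_of_ne_zero hl0) h)]
  have h1 : ∀ e ∈ k.divisors, (μ (l * e) : ℝ) = μ l * μ e := by
    intro e he
    rw [isMultiplicative_moebius.map_mul_of_coprime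
      (hcop.coprime_dvd_right (Nat.dvd_of_mem_divisors he))]
    push_cast; ring
  rw [sum_congr rfl h1, ← mul_sum]
  have h2 : ∑ e ∈ k.divisors, (μ e : ℝ) = if k = 1 then 1 else 0 := by
    rw [← ArithmeticFunction.one_apply, ← coe_moebius_mul_coe_zeta, coe_mul_zeta_apply]
    simp
  rw [h2]
  by_cases hk : k = 1
  · simp [hk]
  · have : l ≠ l * k := by
      intro h
      exact hk (Nat.eq_of_mul_eq_mul_left (Nat.pos_of_ne_zero hl0) (by rw [← h, mul_one]))
    simp [hk, this]

/-- These sums are the coordinates that diagonalize Selberg's quadratic form. Möbius inversion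
collapses the double sum to the term `m = l`. -/
theorem sum_nu_mul_optimalWeights {D l : ℕ} (hl : l ∣ s.prodPrimes) :
    (∑ d ∈ s.prodPrimes.divisors, if l ∣ d then s.nu d * s.optimalWeights D d else 0) =
      if l ≤ D then μ l * s.selbergTerms l / s.selbergSum D else 0 := by
  have h1 : ∀ d ∈ s.prodPrimes.divisors, s.nu d * s.optimalWeights D d =
      ∑ m ∈ s.prodPrimes.divisors with m ≤ D,
        if d ∣ m then (μ d : ℝ) * (s.selbergTerms m / s.selbergSum D) else 0 := by
    intro d hd
    have hnu := nu_ne_zero (s := s) (Nat.dvd_of_mem_divisors hd)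
    rw [optimalWeights, ← mul_assoc, mul_inv_cancel₀ hnu, one_mul, ← sum_filter, filter_filter,
      mul_sum]
    exact sum_congr rfl fun m _ => by ring
  rw [← sum_filter, sum_congr rfl (fun d hd => h1 d (mem_filter.1 hd).1), sum_comm]
  have h2 : ∀ m ∈ s.prodPrimes.divisors.filter (· ≤ D),
      (∑ d ∈ s.prodPrimes.divisors with l ∣ d,
        if d ∣ m then (μ d : ℝ) * (s.selbergTerms m / s.selbergSum D) else 0) =
      if l = m then (μ l : ℝ) * (s.selbergTerms m / s.selbergSum D) else 0 := by
    intro m hm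
    have hmP := Nat.dvd_of_mem_divisors (mem_filter.1 hm).1
    rw [← sum_filter, filter_filter, ← sum_mul]
    by_cases hlm : l ∣ m
    · rw [sum_moebius_of_dvd s.prodPrimes_squarefree hmP hlm, ite_mul, zero_mul]
    · rw [filter_eq_empty_iff.2, sum_empty, zero_mul, if_neg]
      · rintro rfl; exact hlm dvd_rfl
      · rintro d - ⟨h, h'⟩; exact hlm (h.trans h')
  rw [sum_congr rfl h2, sum_ite_eq]
  simp only [mem_filter, Nat.mem_divisors, hl, ne_eq, prodPrimes_ne_zero, not_false_eq_true,
    true_and, mul_div_assoc]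

/-- In diagonal coordinates the form is `∑ g(l)⁻¹ y_l²` with `y_l = μ(l) g(l) / S` for `l ≤ D`, so
it equals `∑ g(l) / S² = 1 / S`. -/
theorem mainSum_optimalWeights {D : ℕ} (hD : 1 ≤ D) :
    s.mainSum (lambdaSquared (s.optimalWeights D)) = (s.selbergSum D)⁻¹ := by
  have hS := (s.selbergSum_pos hD).ne'
  rw [mainSum_lambdaSquared_eq_sum_mul_sum_sq]
  have h1 : ∀ l ∈ s.prodPrimes.divisors, (s.selbergTerms l)⁻¹ *
      (∑ d ∈ s.prodPrimes.divisors, if l ∣ d then s.nu d * s.optimalWeights D d else 0) ^ 2 =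
      if l ≤ D then s.selbergTerms l / s.selbergSum D ^ 2 else 0 := by
    intro l hl
    have hlP := Nat.dvd_of_mem_divisors hl
    have hg := (selbergTerms_pos (s := s) hlP).ne'
    have hmu : (μ l : ℝ) ^ 2 = 1 := by
      exact_mod_cast moebius_sq_eq_one_of_squarefree (squarefree_of_dvd_prodPrimes hlP)
    rw [sum_nu_mul_optimalWeights s hlP]
    split_ifs
    · rw [div_pow, mul_pow, hmu]
      field_simp
    · simp
  rw [sum_congr rfl h1, ← sum_filter, ← sum_div]
  change s.selbergSum D / s.selbergSum D ^ 2 = _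
  field_simp

/-- A Selberg upper bound sieve with a crude error term. -/
theorem siftedSum_le {D : ℕ} (hD : 1 ≤ D) (hrem : ∀ d, d ∣ s.prodPrimes → |s.rem d| ≤ d)
    (hnu : ∀ d, d ∣ s.prodPrimes → (s.nu d)⁻¹ ≤ d) :
    s.siftedSum ≤ s.totalMass / s.selbergSum D + (D : ℝ) ^ 8 := by
  have h := siftedSum_le_mainSum_errSum_of_upperMoebius (s := s) _
    (upperMoebius_lambdaSquared _ (s.optimalWeights_one hD))
  rw [mainSum_optimalWeights s hD, ← div_eq_mul_inv] at h
  refine h.trans (add_le_add_right ?_ _)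
  have hw : ∀ d, d ∣ s.prodPrimes → |s.optimalWeights D d| ≤ if d ≤ D then (D : ℝ) else 0 := by
    intro d hd
    split_ifs with hdD
    · exact ((s.abs_optimalWeights_le hd hD).trans (hnu d hd)).trans (by exact_mod_cast hdD)
    · rw [s.optimalWeights_eq_zero (not_le.1 hdD), abs_zero]
  have hcard : ∀ d, d ∣ s.prodPrimes → (#{e ∈ d.divisors | e ≤ D} : ℝ) ≤ D := by
    intro d hd
    have : {e ∈ d.divisors | e ≤ D} ⊆ Icc 1 D := by
      intro e he
      simp only [mem_filter] at he
      exact mem_Icc.2 ⟨Nat.pos_of_mem_divisors he.1, he.2⟩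
    simpa using (Nat.cast_le (α := ℝ)).2 (card_le_card this)
  -- At most `D²` pairs `(a, b)` contribute, each at most `D²`, and `lcm(a, b) ≤ D²`. With
  -- remainders at most `D²` and at most `D²` moduli `d`, the error totals `D ^ 8`.
  have hlam : ∀ d, d ∣ s.prodPrimes →
      |lambdaSquared (s.optimalWeights D) d| ≤ if d ≤ D ^ 2 then (D : ℝ) ^ 4 else 0 := by
    intro d hd
    have hterm : ∀ a ∈ d.divisors, ∀ b ∈ d.divisors,
        |if d = a.lcm b then s.optimalWeights D a * s.optimalWeights D b else 0| ≤
          if d ≤ D ^ 2 then (if a ≤ D then (D : ℝ) else 0) * (if b ≤ D then (D : ℝ) else 0)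
            else 0 := by
      intro a ha b hb
      have ha' := hw a ((Nat.dvd_of_mem_divisors ha).trans hd)
      have hb' := hw b ((Nat.dvd_of_mem_divisors hb).trans hd)
      have hmul := mul_le_mul ha' hb' (abs_nonneg _) ((abs_nonneg _).trans ha')
      rw [← abs_mul] at hmul
      by_cases hdD : d ≤ D ^ 2
      · rw [if_pos hdD]
        by_cases h1 : d = a.lcm b
        · rw [if_pos h1]
          exact hmul
        · rw [if_neg h1, abs_zero]
          exact (abs_nonneg _).trans hmul
      · rw [if_neg hdD]
        split_ifs with h1
        · refine hmul.trans ?_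
          by_cases haD : a ≤ D
          · by_cases hbD : b ≤ D
            · exfalso
              apply hdD
              rw [h1, sq]
              exact (Nat.le_of_dvd (Nat.mul_pos (Nat.pos_of_mem_divisors ha)
                (Nat.pos_of_mem_divisors hb)) (Nat.lcm_dvd_mul a b)).trans
                (Nat.mul_le_mul haD hbD)
            · simp [hbD]
          · simp [haD]
        · simp
    unfold lambdaSquared
    refine (abs_sum_le_sum_abs _ _).trans ((sum_le_sum fun a ha =>
      (abs_sum_le_sum_abs _ _).trans (sum_le_sum fun b hb => hterm a ha b hb)).trans ?_)
    by_cases hdD : d ≤ D ^ 2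
    · simp only [hdD, if_true]
      rw [← sum_mul_sum, ← sum_filter, sum_const, nsmul_eq_mul]
      have := hcard d hd
      have hD0 : (0 : ℝ) ≤ D := by positivity
      calc _ ≤ ((D : ℝ) * D) * (D * D) := by gcongr
        _ = _ := by ring
    · simp [hdD]
  unfold errSum
  calc ∑ d ∈ s.prodPrimes.divisors, |lambdaSquared (s.optimalWeights D) d| * |s.rem d|
      ≤ ∑ d ∈ s.prodPrimes.divisors, if d ≤ D ^ 2 then (D : ℝ) ^ 4 * D ^ 2 else 0 := by
        refine sum_le_sum fun d hd => ?_
        have hd' := Nat.dvd_of_mem_divisors hd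
        refine (mul_le_mul (hlam d hd') (hrem d hd') (abs_nonneg _)
          ((abs_nonneg _).trans (hlam d hd'))).trans ?_
        split_ifs with h1
        · gcongr
          exact_mod_cast h1
        · simp
    _ = (#{d ∈ s.prodPrimes.divisors | d ≤ D ^ 2} : ℝ) * ((D : ℝ) ^ 4 * D ^ 2) := by
        rw [← sum_filter, sum_const, nsmul_eq_mul]
    _ ≤ (D : ℝ) ^ 2 * ((D : ℝ) ^ 4 * D ^ 2) := by
        gcongr
        have : {e ∈ s.prodPrimes.divisors | e ≤ D ^ 2} ⊆ Icc 1 (D ^ 2) := by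
          intro e he
          simp only [mem_filter] at he
          exact mem_Icc.2 ⟨Nat.pos_of_mem_divisors he.1, he.2⟩
        have := (Nat.cast_le (α := ℝ)).2 (card_le_card this)
        simpa using this
    _ = (D : ℝ) ^ 8 := by ring

end BoundingSieve

end

/-! ### Lower bound for the Selberg sum in dimension two. -/

section

open Finset

/-- The Euler factor `∏_{p ∣ m} (1 - 1/p)⁻¹`. -/
noncomputable def eulerFactor (m : ℕ) : ℝ :=
  ∏ p ∈ m.primeFactors, (1 - (p : ℝ)⁻¹)⁻¹

theorem one_sub_inv_prime_pos {p : ℕ} (hp : p.Prime) : 0 < 1 - (p : ℝ)⁻¹ := by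
  have : (1 : ℝ) < p := by exact_mod_cast hp.one_lt
  have := inv_lt_one_of_one_lt₀ this
  linarith

theorem one_le_inv_one_sub_inv {p : ℕ} (hp : p.Prime) : 1 ≤ (1 - (p : ℝ)⁻¹)⁻¹ := by
  rw [one_le_inv₀ (one_sub_inv_prime_pos hp)]
  have : (0 : ℝ) ≤ (p : ℝ)⁻¹ := by positivity
  linarith

theorem one_le_eulerFactor (m : ℕ) : 1 ≤ eulerFactor m :=
  prod_induction _ (1 ≤ ·) (fun _ _ => one_le_mul_of_one_le_of_one_le) le_rfl fun _ hp =>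
    one_le_inv_one_sub_inv (Nat.prime_of_mem_primeFactors hp)

theorem eulerFactor_pos (m : ℕ) : 0 < eulerFactor m :=
  one_pos.trans_le (one_le_eulerFactor m)

/-- The Euler product is the full sum of `1/n` over the integers composed of primes of `S`; `T`
selects finitely many of its nonnegative terms. -/
theorem sum_inv_le_prod_of_subset_factoredNumbers {S T : Finset ℕ} (hS : ∀ p ∈ S, p.Prime)
    (hT : ∀ n ∈ T, n ∈ Nat.factoredNumbers S) :
    ∑ n ∈ T, (n : ℝ)⁻¹ ≤ ∏ p ∈ S, (1 - (p : ℝ)⁻¹)⁻¹ := by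
  let f : ℕ →* ℝ :=
    { toFun := fun n => (n : ℝ)⁻¹
      map_one' := by simp
      map_mul' := fun a b => by simp [mul_comm] }
  have hf : ∀ {p : ℕ}, p.Prime → ‖f p‖ < 1 := by
    intro p hp
    have : (1 : ℝ) < p := by exact_mod_cast hp.one_lt
    change ‖(p : ℝ)⁻¹‖ < 1
    rw [norm_inv, Real.norm_natCast]
    exact inv_lt_one_of_one_lt₀ this
  have h := (EulerProduct.summable_and_hasSum_factoredNumbers_prod_filter_prime_geometric hf S).2
  rw [filter_true_of_mem hS] at h
  let ι : T ↪ Nat.factoredNumbers S := ⟨fun n => ⟨n.1, hT n.1 n.2⟩,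
    fun a b hab => Subtype.ext (congrArg (fun z : Nat.factoredNumbers S => (z : ℕ)) hab)⟩
  have h2 := sum_le_hasSum (T.attach.map ι)
    (fun i _ => by change (0 : ℝ) ≤ ((i : ℕ) : ℝ)⁻¹; positivity) h
  rw [sum_map] at h2
  rw [← sum_attach]
  exact h2

/-- Each element of `T` lies in both sets, only in `A`, or only in `B`, contributing `h²`, `h` and
`h`. For fixed `A`, the set `B` is `T \ A` together with an arbitrary subset of `A`. -/
theorem sum_powerset_union_eq {α : Type*} [DecidableEq α] (T : Finset α) (h : α → ℝ) :
    ∑ A ∈ T.powerset, ∑ B ∈ T.powerset with A ∪ B = T, (∏ i ∈ A, h i) * ∏ i ∈ B, h i =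
      ∏ i ∈ T, (h i * (1 + h i) + h i) := by
  rw [prod_add]
  refine sum_congr rfl fun A hA => ?_
  have hAT := mem_powerset.1 hA
  have hset : {B ∈ T.powerset | A ∪ B = T} = A.powerset.image (T \ A ∪ ·) := by
    ext B
    simp only [mem_filter, mem_powerset, mem_image]
    constructor
    · rintro ⟨hB, hAB⟩
      refine ⟨A ∩ B, inter_subset_left, ?_⟩
      rw [← hAB]
      ext i
      simp only [mem_union, mem_sdiff, mem_inter]
      tauto
    · rintro ⟨U, hU, rfl⟩
      refine ⟨union_subset sdiff_subset (hU.trans hAT), ?_⟩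
      rw [← union_assoc, union_sdiff_of_subset hAT]
      exact union_eq_left.2 (hU.trans hAT)
  rw [hset, sum_image, prod_mul_distrib, prod_one_add, mul_assoc, ← mul_sum, sum_mul]
  · congr 1
    refine sum_congr rfl fun U hU => ?_
    rw [prod_union (disjoint_of_subset_right (mem_powerset.1 hU) sdiff_disjoint), mul_comm]
  · intro U hU V hV hUV
    have hU' := mem_powerset.1 hU
    have hV' := mem_powerset.1 hV
    have key : ∀ W ⊆ A, (T \ A ∪ W) ∩ A = W := by
      intro W hW
      ext i
      have := @hW i
      simp only [mem_union, mem_sdiff, mem_inter]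
      tauto
    rw [← key U hU', ← key V hV']
    exact congrArg (· ∩ A) hUV

theorem Nat.primeFactors_lcm_eq_union {a b : ℕ} (ha : a ≠ 0) (hb : b ≠ 0) :
    (a.lcm b).primeFactors = a.primeFactors ∪ b.primeFactors := by
  ext p
  simp only [Nat.mem_primeFactors, mem_union, ne_eq, Nat.lcm_eq_zero_iff, ha, hb, or_self,
    not_false_eq_true, and_true]
  constructor
  · rintro ⟨hp, h⟩
    rcases (hp.dvd_mul.1 (h.trans (Nat.lcm_dvd_mul a b))) with h | h <;> simp [hp, h]
  · rintro (⟨hp, h⟩ | ⟨hp, h⟩)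
    · exact ⟨hp, h.trans (Nat.dvd_lcm_left a b)⟩
    · exact ⟨hp, h.trans (Nat.dvd_lcm_right a b)⟩

theorem sum_lcm_eq_le {P l : ℕ} (hP : Squarefree P) {h : ℕ → ℝ}
    (h0 : ∀ p ∈ l.primeFactors, 0 ≤ h p) :
    ∑ x ∈ P.divisors ×ˢ P.divisors with x.1.lcm x.2 = l,
      (∏ p ∈ x.1.primeFactors, h p) * ∏ p ∈ x.2.primeFactors, h p ≤
      ∏ p ∈ l.primeFactors, (h p * (1 + h p) + h p) := by
  have hsub : ∀ x ∈ {x ∈ P.divisors ×ˢ P.divisors | x.1.lcm x.2 = l},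
      Squarefree x.1 ∧ Squarefree x.2 ∧ x.1.primeFactors ∪ x.2.primeFactors = l.primeFactors := by
    intro x hx
    simp only [mem_filter, mem_product] at hx
    have h1 := hP.squarefree_of_dvd (Nat.dvd_of_mem_divisors hx.1.1)
    have h2 := hP.squarefree_of_dvd (Nat.dvd_of_mem_divisors hx.1.2)
    exact ⟨h1, h2, by rw [← hx.2, Nat.primeFactors_lcm_eq_union h1.ne_zero h2.ne_zero]⟩
  rw [← sum_powerset_union_eq, sum_sigma']
  let φ : ℕ × ℕ → (_ : Finset ℕ) × Finset ℕ := fun x => ⟨x.1.primeFactors, x.2.primeFactors⟩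
  have hinj : Set.InjOn φ (({x ∈ P.divisors ×ˢ P.divisors | x.1.lcm x.2 = l} :
      Finset (ℕ × ℕ)) : Set (ℕ × ℕ)) := by
    intro x hx y hy hxy
    obtain ⟨hx1, hx2, -⟩ := hsub x hx
    obtain ⟨hy1, hy2, -⟩ := hsub y hy
    simp only [φ, Sigma.mk.injEq, heq_eq_eq] at hxy
    ext
    · rw [← Nat.prod_primeFactors_of_squarefree hx1, hxy.1, Nat.prod_primeFactors_of_squarefree hy1]
    · rw [← Nat.prod_primeFactors_of_squarefree hx2, hxy.2, Nat.prod_primeFactors_of_squarefree hy2]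
  rw [← sum_image (s := {x ∈ P.divisors ×ˢ P.divisors | x.1.lcm x.2 = l}) (g := φ)
    (f := fun y => (∏ p ∈ y.1, h p) * ∏ p ∈ y.2, h p) hinj]
  refine sum_le_sum_of_subset_of_nonneg ?_ ?_
  · intro y hy
    obtain ⟨x, hx, rfl⟩ := mem_image.1 hy
    obtain ⟨-, -, hx3⟩ := hsub x hx
    simp only [φ, mem_sigma, mem_powerset, mem_filter]
    exact ⟨hx3 ▸ subset_union_left, hx3 ▸ subset_union_right, hx3⟩
  · intro y hy _
    simp only [mem_sigma, mem_powerset, mem_filter] at hy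
    exact mul_nonneg (prod_nonneg fun i hi => h0 i (hy.1 hi))
      (prod_nonneg fun i hi => h0 i (hy.2.1 hi))

/-- Reduces a two-dimensional sum to the square of a one-dimensional one: pairs of divisors up to
`E` are sorted by their lcm, which is at most `E²`. -/
theorem sq_sum_divisors_le {P E : ℕ} (hP : Squarefree P) {h : ℕ → ℝ}
    (h0 : ∀ p, p.Prime → 0 ≤ h p) :
    (∑ l ∈ P.divisors with l ≤ E, ∏ p ∈ l.primeFactors, h p) ^ 2 ≤
      ∑ l ∈ P.divisors with l ≤ E ^ 2, ∏ p ∈ l.primeFactors, (h p * (1 + h p) + h p) := by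
  have h0' : ∀ l : ℕ, ∀ p ∈ l.primeFactors, 0 ≤ h p := fun l p hp =>
    h0 p (Nat.prime_of_mem_primeFactors hp)
  rw [sq, sum_mul_sum, ← sum_product']
  have hmaps : ∀ x ∈ ({l ∈ P.divisors | l ≤ E} ×ˢ {l ∈ P.divisors | l ≤ E} : Finset (ℕ × ℕ)),
      x.1.lcm x.2 ∈ {l ∈ P.divisors | l ≤ E ^ 2} := by
    intro x hx
    simp only [mem_product, mem_filter] at hx
    obtain ⟨⟨h1, h2⟩, h3, h4⟩ := hx
    simp only [mem_filter, Nat.mem_divisors]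
    refine ⟨⟨Nat.lcm_dvd (Nat.dvd_of_mem_divisors h1) (Nat.dvd_of_mem_divisors h3),
      hP.ne_zero⟩, ?_⟩
    rw [sq]
    exact (Nat.le_of_dvd (Nat.mul_pos (Nat.pos_of_mem_divisors h1) (Nat.pos_of_mem_divisors h3))
      (Nat.lcm_dvd_mul _ _)).trans (Nat.mul_le_mul h2 h4)
  rw [← sum_fiberwise_of_maps_to hmaps]
  refine sum_le_sum fun l hl => ?_
  refine le_trans ?_ (sum_lcm_eq_le hP (h0' l))
  refine sum_le_sum_of_subset_of_nonneg ?_ fun x _ _ =>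
    mul_nonneg (prod_nonneg (h0' _)) (prod_nonneg (h0' _))
  intro x hx
  simp only [mem_filter, mem_product] at hx ⊢
  exact ⟨⟨hx.1.1.1, hx.1.2.1⟩, hx.2⟩

/-- Sort `n ≤ E` by the product `l` of its primes not dividing `B`. The cofactor `n / l` is composed
of primes of `B` and `l`, so a fibre sums to at most `l⁻¹ F(B) F(l)`, and `l⁻¹ F(l) = ∏ 1 / (p -
1)`. -/
theorem sum_inv_le_eulerFactor_mul {B P E : ℕ} (hP0 : P ≠ 0)
    (hP : ∀ p, p.Prime → p ≤ E → ¬ p ∣ B → p ∣ P) (hB : B ≠ 0) :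
    ∑ n ∈ Icc 1 E, (n : ℝ)⁻¹ ≤
      eulerFactor B * ∑ l ∈ P.divisors with l ≤ E, ∏ p ∈ l.primeFactors, ((p : ℝ) - 1)⁻¹ := by
  let rad : ℕ → ℕ := fun n => ∏ p ∈ n.primeFactors \ B.primeFactors, p
  have hprime : ∀ n : ℕ, ∀ p ∈ n.primeFactors \ B.primeFactors, p.Prime := fun n p hp =>
    Nat.prime_of_mem_primeFactors (mem_sdiff.1 hp).1
  have hrad : ∀ n, (rad n).primeFactors = n.primeFactors \ B.primeFactors := fun n =>
    Nat.primeFactors_prod (hprime n)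
  have hdvd : ∀ n, rad n ∣ n := fun n =>
    (prod_dvd_prod_of_subset _ _ _ sdiff_subset).trans (Nat.prod_primeFactors_dvd n)
  have hmaps : ∀ n ∈ Icc 1 E, rad n ∈ {l ∈ P.divisors | l ≤ E} := by
    intro n hn
    rw [mem_Icc] at hn
    simp only [mem_filter, Nat.mem_divisors]
    refine ⟨⟨?_, hP0⟩, (Nat.le_of_dvd hn.1 (hdvd n)).trans hn.2⟩
    refine Finset.prod_primes_dvd P (fun p hp => (hprime n p hp).prime) fun p hp => ?_
    rw [mem_sdiff] at hp
    have hpp := Nat.prime_of_mem_primeFactors hp.1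
    refine hP p hpp ((Nat.le_of_dvd hn.1 (Nat.dvd_of_mem_primeFactors hp.1)).trans hn.2) ?_
    exact fun h => hp.2 (Nat.mem_primeFactors.2 ⟨hpp, h, hB⟩)
  rw [← sum_fiberwise_of_maps_to hmaps, mul_sum]
  refine sum_le_sum fun l hl => ?_
  have hl0 : 0 < l := Nat.pos_of_mem_divisors (mem_filter.1 hl).1
  rcases ({n ∈ Icc 1 E | rad n = l}).eq_empty_or_nonempty with hemp | ⟨n₀, hn₀⟩
  · rw [hemp, sum_empty]
    refine mul_nonneg (eulerFactor_pos B).le (prod_nonneg fun p hp => ?_)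
    have : (1 : ℝ) ≤ p := by exact_mod_cast (Nat.prime_of_mem_primeFactors hp).one_le
    exact inv_nonneg.2 (by linarith)
  have hn₀' := (mem_filter.1 hn₀).2
  have hlprod : l = ∏ p ∈ l.primeFactors, p := by
    conv_rhs => rw [← hn₀', hrad]
    exact hn₀'.symm
  have hdisj : Disjoint B.primeFactors l.primeFactors := by
    rw [← hn₀', hrad]
    exact disjoint_sdiff
  have hdiv : ∀ n ∈ {n ∈ Icc 1 E | rad n = l}, n = l * (n / l) := by
    intro n hn
    rw [Nat.mul_div_cancel' ((mem_filter.1 hn).2 ▸ hdvd n)]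
  have hinj : Set.InjOn (· / l) (({n ∈ Icc 1 E | rad n = l} : Finset ℕ) : Set ℕ) := by
    intro n hn m hm hnm
    rw [hdiv n hn, hdiv m hm]
    exact congrArg (l * ·) hnm
  have hbound := sum_inv_le_prod_of_subset_factoredNumbers
    (S := B.primeFactors ∪ l.primeFactors) (T := {n ∈ Icc 1 E | rad n = l}.image (· / l))
    (fun p hp => by
      rcases mem_union.1 hp with h | h <;> exact Nat.prime_of_mem_primeFactors h)
    (fun m hm => by
      obtain ⟨n, hn, rfl⟩ := mem_image.1 hm
      have hn1 := (mem_Icc.1 (mem_filter.1 hn).1).1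
      have hndiv := hdiv n hn
      have hne : n / l ≠ 0 := by
        intro h
        change n / l = 0 at h
        rw [h] at hndiv
        omega
      refine Nat.mem_factoredNumbers_of_primeFactors_subset hne fun p hp => ?_
      have hp' : p ∈ n.primeFactors :=
        Nat.primeFactors_mono (Nat.div_dvd_of_dvd ((mem_filter.1 hn).2 ▸ hdvd n)) (by omega) hp
      rw [mem_union, ← (mem_filter.1 hn).2, hrad, mem_sdiff]
      tauto)
  rw [sum_image hinj, prod_union hdisj] at hbound
  have hsum : ∑ n ∈ Icc 1 E with rad n = l, (n : ℝ)⁻¹ =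
      (l : ℝ)⁻¹ * ∑ n ∈ Icc 1 E with rad n = l, ((n / l : ℕ) : ℝ)⁻¹ := by
    rw [mul_sum]
    refine sum_congr rfl fun n hn => ?_
    conv_lhs => rw [hdiv n hn]
    push_cast
    rw [mul_inv]
  rw [hsum]
  refine (mul_le_mul_of_nonneg_left hbound (by positivity)).trans (le_of_eq ?_)
  rw [mul_left_comm]
  change eulerFactor B * _ = _
  congr 1
  conv_lhs => rw [hlprod]
  push_cast
  rw [← hlprod, ← prod_inv_distrib, ← prod_mul_distrib]
  refine prod_congr rfl fun p hp => ?_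
  have : (1 : ℝ) < p := by exact_mod_cast (Nat.prime_of_mem_primeFactors hp).one_lt
  have h1 : (p : ℝ) ≠ 0 := by positivity
  have h2 : (p : ℝ) - 1 ≠ 0 := by linarith
  rw [← mul_inv, mul_sub, mul_one, mul_inv_cancel₀ h1]

/-- Lower bound for the sum of `∏_{p ∣ l} 2 / (p - 2)` in a two-dimensional sieve. -/
theorem sq_log_le_sum_two_div_sub_two {B P E : ℕ} (hP : Squarefree P)
    (hP3 : ∀ p, p.Prime → p ∣ P → 3 ≤ p)
    (hPB : ∀ p, p.Prime → p ≤ E → ¬ p ∣ B → p ∣ P) (hB : B ≠ 0) :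
    Real.log (E + 1) ^ 2 ≤ eulerFactor B ^ 2 *
      ∑ l ∈ P.divisors with l ≤ E ^ 2, ∏ p ∈ l.primeFactors, (2 / ((p : ℝ) - 2)) := by
  have h1 := sum_inv_le_eulerFactor_mul hP.ne_zero hPB hB
  have h2 : Real.log (E + 1) ≤ ∑ n ∈ Icc 1 E, (n : ℝ)⁻¹ := by
    have := log_add_one_le_harmonic E
    rw [harmonic_eq_sum_Icc] at this
    push_cast at this
    exact_mod_cast this
  have hlog : 0 ≤ Real.log (E + 1) := Real.log_nonneg (by simp)
  have h3 := sq_sum_divisors_le (E := E) hP (h := fun p => ((p : ℝ) - 1)⁻¹) fun p hp => by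
    have : (1 : ℝ) ≤ p := by exact_mod_cast hp.one_le
    exact inv_nonneg.2 (by linarith)
  calc Real.log (E + 1) ^ 2 ≤ (eulerFactor B *
        ∑ l ∈ P.divisors with l ≤ E, ∏ p ∈ l.primeFactors, ((p : ℝ) - 1)⁻¹) ^ 2 := by
        gcongr
        exact h2.trans h1
    _ ≤ _ := by
        rw [mul_pow]
        refine mul_le_mul_of_nonneg_left (h3.trans ?_) (by positivity)
        refine sum_le_sum fun l hl => prod_le_prod (fun p hp => ?_) fun p hp => ?_
        · have : (1 : ℝ) ≤ p := by exact_mod_cast (Nat.prime_of_mem_primeFactors hp).one_le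
          have := inv_nonneg.2 (sub_nonneg.2 this)
          positivity
        · have hl' := Nat.dvd_of_mem_divisors (mem_filter.1 hl).1
          have h3p : (3 : ℝ) ≤ p := by
            exact_mod_cast hP3 p (Nat.prime_of_mem_primeFactors hp)
              ((Nat.dvd_of_mem_primeFactors hp).trans hl')
          have ha : (0 : ℝ) < p - 1 := by linarith
          have hb : (0 : ℝ) < p - 2 := by linarith
          -- With `h = 1 / (p - 1)` one has `h (1 + h) + h = (2p - 1) / (p - 1)²`, and `(2p - 1)(p -
          -- 2) ≤ 2 (p - 1)²`.
          rw [le_div_iff₀ hb]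
          field_simp
          nlinarith

end

/-! ### The sieve problem for a product of two linear forms. -/

section

open Finset ArithmeticFunction
open scoped ArithmeticFunction.Moebius ArithmeticFunction.sigma

theorem exists_dvd_linear_iff_modEq {a : ℕ} (ha : 0 < a) {α β : ℤ} (h : IsCoprime α a) :
    ∃ v : ℕ, ∀ n : ℕ, (a : ℤ) ∣ α * n + β ↔ n ≡ v [MOD a] := by
  obtain ⟨u, w, huw⟩ := h
  have ha' : (a : ℤ) ≠ 0 := by exact_mod_cast ha.ne'
  refine ⟨((-(u * β)) % a).toNat, fun n => ?_⟩
  have hv : ((((-(u * β)) % a).toNat : ℕ) : ℤ) = (-(u * β)) % a :=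
    Int.toNat_of_nonneg (Int.emod_nonneg _ ha')
  rw [← Int.natCast_modEq_iff, hv]
  have h1 : (n : ℤ) ≡ (-(u * β)) % a [ZMOD a] ↔ (a : ℤ) ∣ -(u * β) - n := by
    rw [← Int.modEq_iff_dvd]
    exact ⟨fun h => h.trans (Int.mod_modEq _ _), fun h => h.trans (Int.mod_modEq _ _).symm⟩
  rw [h1]
  constructor
  · rintro ⟨k, hk⟩
    exact ⟨-(w * n) - u * k, by linear_combination (-u) * hk + (n : ℤ) * huw⟩
  · rintro ⟨k, hk⟩
    exact ⟨w * β - α * k, by linear_combination (-α) * hk - β * huw⟩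

theorem exists_dvd_two_linear_iff_modEq {a b : ℕ} (ha : 0 < a) (hb : 0 < b) (hab : a.Coprime b)
    {α β γ δ : ℤ} (hα : IsCoprime α a) (hγ : IsCoprime γ b) :
    ∃ v : ℕ, ∀ n : ℕ, ((a : ℤ) ∣ α * n + β ∧ (b : ℤ) ∣ γ * n + δ) ↔ n ≡ v [MOD a * b] := by
  obtain ⟨v₁, h₁⟩ := exists_dvd_linear_iff_modEq ha (β := β) hα
  obtain ⟨v₂, h₂⟩ := exists_dvd_linear_iff_modEq hb (β := δ) hγ
  obtain ⟨k, hk₁, hk₂⟩ := Nat.chineseRemainder hab v₁ v₂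
  refine ⟨k, fun n => ?_⟩
  rw [h₁, h₂, ← Nat.modEq_and_modEq_iff_modEq_mul hab]
  exact ⟨fun h => ⟨h.1.trans hk₁.symm, h.2.trans hk₂.symm⟩,
    fun h => ⟨h.1.trans hk₁, h.2.trans hk₂⟩⟩

theorem abs_card_modEq_sub_le {r : ℕ} (hr : 0 < r) (v N : ℕ) :
    |(#{n ∈ range N | n ≡ v [MOD r]} : ℝ) - N / r| ≤ 1 := by
  rw [← Nat.count_eq_card_filter_range, Nat.count_modEq_card _ hr]
  have h1 : ((N / r : ℕ) : ℝ) ≤ (N : ℝ) / r := Nat.cast_div_le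
  have h2 : (N : ℝ) / r < ((N / r : ℕ) : ℝ) + 1 := by
    rw [div_lt_iff₀ (by exact_mod_cast hr)]
    exact_mod_cast Nat.lt_mul_of_div_lt (Nat.lt_succ_self _) hr
  rw [abs_le]
  push_cast
  split_ifs <;> constructor <;> simp <;> linarith

/-- A prime of `d` never divides both `x` and `y`, so a factorization `d = a b` with `a ∣ x`, `b ∣
y` must have `a = gcd(d, x)`. This turns divisibility of a product into a sum over factorizations.
-/
theorem card_divisorsAntidiagonal_dvd_dvd {d : ℕ} (hd : d ≠ 0) {x y : ℤ}
    (h : ∀ p : ℕ, p.Prime → p ∣ d → (p : ℤ) ∣ x → ¬ (p : ℤ) ∣ y) :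
    #{z ∈ d.divisorsAntidiagonal | (z.1 : ℤ) ∣ x ∧ (z.2 : ℤ) ∣ y} =
      if d ∣ (x * y).natAbs then 1 else 0 := by
  simp only [Int.natCast_dvd, Int.natAbs_mul]
  generalize hX : x.natAbs = X
  generalize hY : y.natAbs = Y
  have h' : ∀ p : ℕ, p.Prime → p ∣ d → p ∣ X → ¬ p ∣ Y := by
    intro p hp hpd
    rw [← hX, ← hY, ← Int.natCast_dvd, ← Int.natCast_dvd]
    exact h p hp hpd
  split_ifs with hdv
  · rw [card_eq_one]
    refine ⟨(d.gcd X, d / d.gcd X), ?_⟩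
    have hg0 : 0 < d.gcd X := Nat.gcd_pos_of_pos_left _ (Nat.pos_of_ne_zero hd)
    ext ⟨a, b⟩
    simp only [mem_filter, Nat.mem_divisorsAntidiagonal, mem_singleton, Prod.mk.injEq]
    constructor
    · rintro ⟨⟨hab, -⟩, haX, hbY⟩
      have hbX : b.Coprime X := by
        refine Nat.coprime_of_dvd fun p hp hpb hpX => ?_
        exact h' p hp (hab ▸ hpb.trans (dvd_mul_left b a)) hpX (hpb.trans hbY)
      have hga : d.gcd X = a := by
        rw [← hab, Nat.Coprime.gcd_mul_right_cancel a hbX]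
        exact Nat.gcd_eq_left haX
      refine ⟨hga.symm, ?_⟩
      rw [hga, ← hab, Nat.mul_div_cancel_left _ (hga ▸ hg0)]
    · rintro ⟨rfl, rfl⟩
      refine ⟨⟨Nat.mul_div_cancel' (Nat.gcd_dvd_left d X), hd⟩, Nat.gcd_dvd_right d X, ?_⟩
      have hc := Nat.coprime_div_gcd_div_gcd hg0
      refine hc.dvd_of_dvd_mul_left ?_
      refine Nat.dvd_of_mul_dvd_mul_left hg0 ?_
      rw [Nat.mul_div_cancel' (Nat.gcd_dvd_left d X), ← mul_assoc,
        Nat.mul_div_cancel' (Nat.gcd_dvd_right d X)]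
      exact hdv
  · rw [card_eq_zero, filter_eq_empty_iff]
    rintro ⟨a, b⟩ hab ⟨haX, hbY⟩
    rw [Nat.mem_divisorsAntidiagonal] at hab
    exact hdv (hab.1 ▸ mul_dvd_mul haX hbY)

/-- The arithmetic function `τ(d) / d`. -/
noncomputable def divisorDensity : ArithmeticFunction ℝ :=
  pdiv ((σ 0 : ArithmeticFunction ℕ) : ArithmeticFunction ℝ)
    ((ArithmeticFunction.id : ArithmeticFunction ℕ) : ArithmeticFunction ℝ)

theorem divisorDensity_apply (d : ℕ) : divisorDensity d = (#d.divisors : ℝ) / d := by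
  simp [divisorDensity, pdiv_apply, sigma_zero_apply]

theorem divisorDensity_isMultiplicative : divisorDensity.IsMultiplicative := by
  unfold divisorDensity
  arith_mult

theorem divisorDensity_prime {p : ℕ} (hp : p.Prime) : divisorDensity p = 2 / p := by
  rw [divisorDensity_apply, hp.divisors, card_pair hp.one_lt.ne]
  simp

/-- The absolute value of the product of two integer linear forms. -/
def twoForms (α β γ δ : ℤ) (n : ℕ) : ℕ := ((α * n + β) * (γ * n + δ)).natAbs

/-- Each of the `τ(d)` factorizations `d = a b` imposes a single residue class modulo `d`, with
error at most 1. A prime dividing both forms would divide the determinant, which the hypothesis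
excludes. -/
theorem abs_card_dvd_mul_sub_le {d : ℕ} (hd : Squarefree d) {α β γ δ : ℤ} (N : ℕ)
    (h : ∀ p : ℕ, p.Prime → p ∣ d → ¬ (p : ℤ) ∣ α * γ * (α * δ - β * γ)) :
    |(#{n ∈ range N | d ∣ twoForms α β γ δ n} : ℝ) -
      divisorDensity d * N| ≤ d := by
  have hd0 := hd.ne_zero
  have hcount : (#{n ∈ range N | d ∣ twoForms α β γ δ n} : ℝ) =
      ∑ z ∈ d.divisorsAntidiagonal,
        (#{n ∈ range N | (z.1 : ℤ) ∣ α * (n : ℕ) + β ∧ (z.2 : ℤ) ∣ γ * (n : ℕ) + δ} : ℝ) := by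
    simp only [card_filter _ (range N)]
    push_cast
    rw [sum_comm]
    refine sum_congr rfl fun n _ => ?_
    rw [sum_boole, twoForms, card_divisorsAntidiagonal_dvd_dvd hd0]
    · push_cast
      rfl
    intro p hp hpd hx hy
    refine h p hp hpd (Dvd.dvd.mul_left ?_ _)
    have : α * δ - β * γ = α * (γ * n + δ) - γ * (α * n + β) := by ring
    rw [this]
    exact dvd_sub (hy.mul_left _) (hx.mul_left _)
  have hterm : ∀ z ∈ d.divisorsAntidiagonal,
      |(#{n ∈ range N | (z.1 : ℤ) ∣ α * (n : ℕ) + β ∧ (z.2 : ℤ) ∣ γ * (n : ℕ) + δ} : ℝ)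
        - N / d| ≤ 1 := by
    rintro ⟨a, b⟩ hz
    obtain ⟨hab, -⟩ := Nat.mem_divisorsAntidiagonal.1 hz
    simp only at hab ⊢
    have hcop : ∀ e : ℕ, e ∣ d → ∀ x : ℤ, x ∣ α * γ * (α * δ - β * γ) → IsCoprime x e := by
      intro e he x hx
      rw [Int.isCoprime_iff_gcd_eq_one]
      change Nat.Coprime x.natAbs e
      refine Nat.coprime_of_dvd fun p hp hpx hpe => ?_
      refine h p hp (hpe.trans he) (dvd_trans ?_ hx)
      exact Int.natCast_dvd.2 hpx
    have ha0 : 0 < a := Nat.pos_of_ne_zero (by rintro rfl; simp at hab; omega)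
    have hb0 : 0 < b := Nat.pos_of_ne_zero (by rintro rfl; simp at hab; omega)
    obtain ⟨v, hv⟩ := exists_dvd_two_linear_iff_modEq (β := β) (δ := δ) ha0 hb0
      (Nat.squarefree_mul_iff.1 (hab ▸ hd)).1
      (hcop a (hab ▸ dvd_mul_right a b) α ((dvd_mul_right α γ).mul_right _))
      (hcop b (hab ▸ dvd_mul_left b a) γ ((dvd_mul_left γ α).mul_right _))
    simp_rw [hv, hab]
    exact abs_card_modEq_sub_le (Nat.pos_of_ne_zero hd0) v N
  have hcardanti : (#d.divisorsAntidiagonal : ℝ) = #d.divisors := by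
    rw [← Nat.map_div_right_divisors, card_map]
  have hmain : divisorDensity d * N = ∑ z ∈ d.divisorsAntidiagonal, (N : ℝ) / d := by
    rw [sum_const, nsmul_eq_mul, hcardanti, divisorDensity_apply]
    ring
  rw [hcount, hmain, ← sum_sub_distrib]
  refine (abs_sum_le_sum_abs _ _).trans ((sum_le_sum hterm).trans ?_)
  rw [sum_const, nsmul_eq_mul, mul_one, hcardanti]
  exact_mod_cast Nat.card_divisors_le_self d

/-- The sieve problem for the product of two linear forms. -/
noncomputable def twoFormsSieve (α β γ δ : ℤ) (N P : ℕ) (hP : Squarefree P)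
    (hP3 : ∀ p, p.Prime → p ∣ P → 3 ≤ p) : BoundingSieve where
  support := (range N).image (twoForms α β γ δ)
  prodPrimes := P
  prodPrimes_squarefree := hP
  weights := fun m => #{n ∈ range N | twoForms α β γ δ n = m}
  weights_nonneg := fun _ => Nat.cast_nonneg _
  totalMass := N
  nu := divisorDensity
  nu_mult := divisorDensity_isMultiplicative
  nu_pos_of_prime := fun p hp _ => by
    rw [divisorDensity_prime hp]
    have := hp.pos
    positivity
  nu_lt_one_of_prime := fun p hp hpP => by
    rw [divisorDensity_prime hp, div_lt_one (by exact_mod_cast hp.pos)]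
    exact_mod_cast hP3 p hp hpP

theorem sum_image_card_fiber_ite {ι : Type*} (s : Finset ι) (f : ι → ℕ) (q : ℕ → Prop)
    [DecidablePred q] :
    (∑ m ∈ s.image f, if q m then (#{n ∈ s | f n = m} : ℝ) else 0) = #{n ∈ s | q (f n)} := by
  rw [card_filter, ← sum_fiberwise_of_maps_to (t := s.image f) (g := f)
    (fun i hi => mem_image_of_mem f hi)]
  push_cast
  refine sum_congr rfl fun m _ => ?_
  rw [sum_congr rfl (g := fun _ => if q m then (1 : ℝ) else 0)
    (fun n hn => by rw [(mem_filter.1 hn).2])]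
  split_ifs <;> simp

theorem card_coprime_two_forms_le {α β γ δ : ℤ} {N P B E : ℕ} (hP : Squarefree P)
    (hP3 : ∀ p, p.Prime → p ∣ P → 3 ≤ p) (hB : B ≠ 0)
    (hPB : ∀ p, p.Prime → p ≤ E → ¬ p ∣ B → p ∣ P) (hE : 1 ≤ E)
    (h : ∀ p : ℕ, p.Prime → p ∣ P → ¬ (p : ℤ) ∣ α * γ * (α * δ - β * γ)) :
    (#{n ∈ range N | P.Coprime (twoForms α β γ δ n)} : ℝ) ≤
      N * eulerFactor B ^ 2 / Real.log (E + 1) ^ 2 + (E : ℝ) ^ 16 := by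
  set s := twoFormsSieve α β γ δ N P hP hP3 with hs
  have hnuapp : ∀ d, s.nu d = (#d.divisors : ℝ) / d := divisorDensity_apply
  have hsift : s.siftedSum =
      #{n ∈ range N | P.Coprime (twoForms α β γ δ n)} :=
    sum_image_card_fiber_ite (range N) (twoForms α β γ δ)
      (fun m => P.Coprime m)
  have hmult : ∀ d, s.multSum d =
      #{n ∈ range N | d ∣ twoForms α β γ δ n} := fun d =>
    sum_image_card_fiber_ite (range N) (twoForms α β γ δ)
      (fun m => d ∣ m)
  -- The lower bound for the Selberg sum runs over `l ≤ E²`, hence `D = E²` and an error `D ^ 8 = E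
  -- ^ 16`.
  have hbound := s.siftedSum_le (D := E ^ 2) (Nat.one_le_pow _ _ hE)
    (fun d hd => by
      rw [BoundingSieve.rem, hmult]
      exact abs_card_dvd_mul_sub_le (hP.squarefree_of_dvd hd) N
        fun p hp hpd => h p hp (hpd.trans hd))
    (fun d hd => by
      have hd0 : d ≠ 0 := (hP.squarefree_of_dvd hd).ne_zero
      have : 1 ≤ #d.divisors := card_pos.2 ⟨1, by simpa using hd0⟩
      rw [hnuapp, inv_div]
      exact div_le_self (Nat.cast_nonneg _) (by exact_mod_cast this))
  rw [hsift] at hbound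
  have hg : s.selbergSum (E ^ 2) =
      ∑ l ∈ P.divisors with l ≤ E ^ 2, ∏ p ∈ l.primeFactors, (2 / ((p : ℝ) - 2)) := by
    refine sum_congr rfl fun l hl => ?_
    have hlP : l ∣ P := Nat.dvd_of_mem_divisors (mem_filter.1 hl).1
    rw [BoundingSieve.selbergTerms_apply, ← BoundingSieve.prod_primeFactors_nu (s := s) hlP,
      ← prod_mul_distrib]
    refine prod_congr rfl fun p hp => ?_
    have hpp := Nat.prime_of_mem_primeFactors hp
    have h3 : (3 : ℝ) ≤ p := by
      exact_mod_cast hP3 p hpp ((Nat.dvd_of_mem_primeFactors hp).trans hlP)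
    have hp0 : (p : ℝ) ≠ 0 := by linarith
    have hp2 : (p : ℝ) - 2 ≠ 0 := by linarith
    have : s.nu p = 2 / p := divisorDensity_prime hpp
    rw [this, one_sub_div hp0, inv_div, div_mul_div_comm, mul_comm (p : ℝ),
      mul_div_mul_right _ _ hp0]
  have hlow := sq_log_le_sum_two_div_sub_two hP hP3 hPB hB
  rw [← hg] at hlow
  have hpos : 0 < s.selbergSum (E ^ 2) := s.selbergSum_pos (Nat.one_le_pow _ _ hE)
  have hlogpos : 0 < Real.log ((E : ℝ) + 1) := Real.log_pos (by
    have : (1 : ℝ) ≤ E := by exact_mod_cast hE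
    linarith)
  refine hbound.trans (add_le_add ?_ (le_of_eq ?_))
  · change (N : ℝ) / s.selbergSum (E ^ 2) ≤ _
    rw [div_le_div_iff₀ hpos (by positivity), mul_assoc]
    exact mul_le_mul_of_nonneg_left hlow (Nat.cast_nonneg _)
  · push_cast
    ring

end

/-! ### Upper bound for simultaneous prime values of two linear forms. -/

section

open Finset

theorem prod_inv_one_sub_inv_le_of_subset {s t : Finset ℕ} (h : s ⊆ t)
    (ht : ∀ p ∈ t, p.Prime) :
    ∏ p ∈ s, (1 - (p : ℝ)⁻¹)⁻¹ ≤ ∏ p ∈ t, (1 - (p : ℝ)⁻¹)⁻¹ := by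
  rw [← prod_sdiff h]
  refine le_mul_of_one_le_left (prod_nonneg fun p hp =>
    (inv_pos.2 (one_sub_inv_prime_pos (ht p (h hp)))).le) ?_
  exact prod_induction _ (1 ≤ ·) (fun _ _ => one_le_mul_of_one_le_of_one_le) le_rfl
    fun p hp => one_le_inv_one_sub_inv (ht p (mem_sdiff.1 hp).1)

theorem eulerFactor_le_of_primeFactors_subset {a b : ℕ} (h : a.primeFactors ⊆ b.primeFactors) :
    eulerFactor a ≤ eulerFactor b :=
  prod_inv_one_sub_inv_le_of_subset h fun _ hp => Nat.prime_of_mem_primeFactors hp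

theorem eulerFactor_mono {a b : ℕ} (h : a ∣ b) (hb : b ≠ 0) : eulerFactor a ≤ eulerFactor b :=
  eulerFactor_le_of_primeFactors_subset (Nat.primeFactors_mono h hb)

theorem eulerFactor_mul_le {a b : ℕ} (ha : a ≠ 0) (hb : b ≠ 0) :
    eulerFactor (a * b) ≤ eulerFactor a * eulerFactor b := by
  have h1 : (a * b).primeFactors = a.primeFactors ∪ (b.primeFactors \ a.primeFactors) := by
    rw [Nat.primeFactors_mul ha hb, union_sdiff_self_eq_union]
  unfold eulerFactor
  rw [h1, prod_union disjoint_sdiff]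
  refine mul_le_mul_of_nonneg_left ?_ (eulerFactor_pos a).le
  exact prod_inv_one_sub_inv_le_of_subset sdiff_subset fun _ hp => Nat.prime_of_mem_primeFactors hp

theorem eulerFactor_prime_pow_le {p : ℕ} (hp : p.Prime) (k : ℕ) : eulerFactor (p ^ k) ≤ 2 := by
  rcases eq_or_ne k 0 with rfl | hk
  · simp [eulerFactor]
  rw [eulerFactor, Nat.primeFactors_prime_pow hk hp, prod_singleton, inv_le_comm₀
    (one_sub_inv_prime_pos hp) two_pos]
  have : (2 : ℝ) ≤ p := by exact_mod_cast hp.two_le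
  have := inv_anti₀ two_pos this
  linarith

theorem eulerFactor_prime_le {p : ℕ} (hp : p.Prime) : eulerFactor p ≤ 2 := by
  simpa using eulerFactor_prime_pow_le hp 1

/-- Handles the `n` at which a form takes a prime value at most `E`; the sieve may discard these. -/
theorem card_natAbs_linear_le {α β : ℤ} (hα : α ≠ 0) (N E : ℕ) :
    #{n ∈ range N | (α * (n : ℕ) + β).natAbs ≤ E} ≤ 2 * E + 1 := by
  have h : #{n ∈ range N | (α * (n : ℕ) + β).natAbs ≤ E} ≤ #(Icc (-E : ℤ) E) := by
    refine card_le_card_of_injOn (fun n => α * (n : ℕ) + β) (fun n hn => ?_) fun n _ m _ hnm => ?_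
    · have := (mem_filter.1 hn).2
      simp only [coe_Icc, Set.mem_Icc]
      omega
    · simpa [hα] using hnm
  rw [Int.card_Icc] at h
  omega

theorem sqrt_le_mul_div_log_sq {x : ℝ} (hx : 1 < x) : √x ≤ 16 * x / Real.log x ^ 2 := by
  have hlog : 0 < Real.log x := Real.log_pos hx
  have h0 : 0 < x := by linarith
  have h1 : Real.log x ≤ 4 * √(√x) := by
    have h4 : x = √(√x) ^ 4 := by
      rw [show (4 : ℕ) = 2 * 2 by norm_num, pow_mul, Real.sq_sqrt (Real.sqrt_nonneg _),
        Real.sq_sqrt h0.le]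
    have hpos : 0 < √(√x) := Real.sqrt_pos.2 (Real.sqrt_pos.2 h0)
    conv_lhs => rw [h4, Real.log_pow]
    have := Real.log_le_sub_one_of_pos hpos
    push_cast
    linarith
  rw [le_div_iff₀ (by positivity)]
  have h2 : Real.log x ^ 2 ≤ 16 * √x := by
    calc Real.log x ^ 2 ≤ (4 * √(√x)) ^ 2 := by gcongr
      _ = 16 * √x := by rw [mul_pow, Real.sq_sqrt (Real.sqrt_nonneg _)]; norm_num
  calc √x * Real.log x ^ 2 ≤ √x * (16 * √x) := by gcongr
    _ = 16 * x := by nlinarith [Real.mul_self_sqrt h0.le]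

/-- Upper bound for the number of simultaneous prime values of two integer linear forms. -/
theorem exists_card_prime_two_forms_le :
    ∃ C : ℝ, 0 < C ∧ ∀ (α β γ δ : ℤ) (N : ℕ), α ≠ 0 → γ ≠ 0 → α * δ - β * γ ≠ 0 → 2 ≤ N →
      (#{n ∈ range N | (α * (n : ℕ) + β).natAbs.Prime ∧ (γ * (n : ℕ) + δ).natAbs.Prime} : ℝ) ≤
        C * N / Real.log N ^ 2 * eulerFactor (α * γ * (α * δ - β * γ)).natAbs ^ 2 := by
  -- `4096 = (2 · 32)²`: the 2 comes from `eulerFactor 2`, the 32 from `log E` against `log N`. `112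
  -- = 7 · 16` absorbs the errors of size `√N`.
  refine ⟨4096 + 112, by norm_num, fun α β γ δ N hα hγ hdet hN => ?_⟩
  set B₀ := (α * γ * (α * δ - β * γ)).natAbs with hB₀
  have hB₀0 : B₀ ≠ 0 := Int.natAbs_ne_zero.2 (mul_ne_zero (mul_ne_zero hα hγ) hdet)
  have hN2 : (2 : ℝ) ≤ N := by exact_mod_cast hN
  have hN1 : (1 : ℝ) < N := by linarith
  have hlogN : 0 < Real.log N := Real.log_pos hN1
  -- The exponent makes the sieve error `E ^ 16` at most `√N`.
  set E := ⌊(N : ℝ) ^ (1 / 32 : ℝ)⌋₊ with hE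
  have hroot : (1 : ℝ) ≤ (N : ℝ) ^ (1 / 32 : ℝ) := Real.one_le_rpow hN1.le (by norm_num)
  have hE1 : 1 ≤ E := Nat.le_floor (by simpa using hroot)
  have hE1' : (1 : ℝ) ≤ E := by exact_mod_cast hE1
  have hE16 : (E : ℝ) ^ 16 ≤ √N := by
    have h1 : (E : ℝ) ≤ (N : ℝ) ^ (1 / 32 : ℝ) := Nat.floor_le (by positivity)
    calc (E : ℝ) ^ 16 ≤ ((N : ℝ) ^ (1 / 32 : ℝ)) ^ 16 := by gcongr
      _ = √N := by
        rw [← Real.rpow_natCast, ← Real.rpow_mul (by positivity), Real.sqrt_eq_rpow]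
        norm_num
  have hlogE : Real.log N / 32 ≤ Real.log ((E : ℝ) + 1) := by
    have h1 : (N : ℝ) ^ (1 / 32 : ℝ) ≤ (E : ℝ) + 1 := (Nat.lt_floor_add_one _).le
    have h2 := Real.log_le_log (by positivity) h1
    rw [Real.log_rpow (by positivity)] at h2
    linarith
  -- The prime 2 is left out because the density `2 / p` must be below 1, and the primes of `B₀`
  -- because there the density need not be `2 / p`. Both losses are paid for by `eulerFactor (2 *
  -- B₀)`.
  set P := ∏ p ∈ range (E + 1) with p.Prime ∧ ¬ p ∣ 2 * B₀, p with hP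
  have hprime : ∀ p ∈ ({p ∈ range (E + 1) | p.Prime ∧ ¬ p ∣ 2 * B₀} : Finset ℕ), p.Prime :=
    fun p hp => (mem_filter.1 hp).2.1
  have hPmem : ∀ p : ℕ, p.Prime → p ∣ P → p ≤ E ∧ ¬ p ∣ 2 * B₀ := by
    intro p hp hpP
    obtain ⟨q, hq, hpq⟩ := (hp.prime.dvd_finsetProd_iff _).1 hpP
    have := (Nat.prime_dvd_prime_iff_eq hp (hprime q hq)).1 hpq
    subst this
    simp only [mem_filter, mem_range] at hq
    exact ⟨by omega, hq.2.2⟩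
  have hPsq : Squarefree P := by
    refine Finset.squarefree_prod_of_pairwise_isCoprime ?_ ?_
    · intro p hp q hq hpq
      exact Nat.coprime_iff_isRelPrime.1 ((Nat.coprime_primes (hprime p hp) (hprime q hq)).2 hpq)
    · exact fun p hp => (hprime p hp).prime.squarefree
  have hP3 : ∀ p, p.Prime → p ∣ P → 3 ≤ p := by
    intro p hp hpP
    have h2 := (hPmem p hp hpP).2
    have : p ≠ 2 := by rintro rfl; exact h2 (dvd_mul_right 2 B₀)
    have := hp.two_le
    omega
  have hsieve := card_coprime_two_forms_le (α := α) (β := β) (γ := γ) (δ := δ) (N := N)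
    (B := 2 * B₀) (E := E) hPsq hP3 (by omega)
    (fun p hp hpE hpB => dvd_prod_of_mem (fun p => p) (mem_filter.2
      ⟨mem_range.2 (by omega), hp, hpB⟩)) hE1
    (fun p hp hpP hpd => (hPmem p hp hpP).2 ((Int.natCast_dvd.1 hpd).mul_left 2))
  have hcover : ({n ∈ range N | (α * (n : ℕ) + β).natAbs.Prime ∧ (γ * (n : ℕ) + δ).natAbs.Prime}
      : Finset ℕ) ⊆ {n ∈ range N | P.Coprime (twoForms α β γ δ n)} ∪
        ({n ∈ range N | (α * (n : ℕ) + β).natAbs ≤ E} ∪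
          {n ∈ range N | (γ * (n : ℕ) + δ).natAbs ≤ E}) := by
    intro n hn
    simp only [mem_filter, mem_union] at hn ⊢
    obtain ⟨hnN, h1, h2⟩ := hn
    by_contra hcon
    push Not at hcon
    obtain ⟨hc, h3, h4⟩ := hcon
    refine hc hnN ?_
    refine Nat.coprime_of_dvd fun p hp hpP hpF => ?_
    have hpE := (hPmem p hp hpP).1
    rw [twoForms, Int.natAbs_mul, hp.dvd_mul, Nat.prime_dvd_prime_iff_eq hp h1,
      Nat.prime_dvd_prime_iff_eq hp h2] at hpF
    have := h3 hnN
    have := h4 hnN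
    omega
  have hcard := (card_le_card hcover).trans ((card_union_le _ _).trans
    (Nat.add_le_add_left ((card_union_le _ _).trans (Nat.add_le_add
      (card_natAbs_linear_le hα N E) (card_natAbs_linear_le hγ N E))) _))
  have hcard' := (Nat.cast_le (α := ℝ)).2 hcard
  push_cast at hcard'
  have hE16' : (E : ℝ) ≤ (E : ℝ) ^ 16 := le_self_pow₀ hE1' (by norm_num)
  have hF : eulerFactor (2 * B₀) ≤ 2 * eulerFactor B₀ :=
    (eulerFactor_mul_le two_ne_zero hB₀0).trans
      (mul_le_mul_of_nonneg_right (eulerFactor_prime_le Nat.prime_two) (eulerFactor_pos _).le)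
  have hmain : N * eulerFactor (2 * B₀) ^ 2 / Real.log ((E : ℝ) + 1) ^ 2 ≤
      4096 * (N / Real.log N ^ 2 * eulerFactor B₀ ^ 2) := by
    calc N * eulerFactor (2 * B₀) ^ 2 / Real.log ((E : ℝ) + 1) ^ 2
        ≤ N * (2 * eulerFactor B₀) ^ 2 / (Real.log N / 32) ^ 2 := by
          have := (eulerFactor_pos (2 * B₀)).le
          gcongr
      _ = 4096 * (N / Real.log N ^ 2 * eulerFactor B₀ ^ 2) := by
          field_simp
          ring
  have herr : 7 * √(N : ℝ) ≤ 112 * (N / Real.log N ^ 2 * eulerFactor B₀ ^ 2) := by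
    have h1 := sqrt_le_mul_div_log_sq hN1
    have h2 : (1 : ℝ) ≤ eulerFactor B₀ ^ 2 := one_le_pow₀ (one_le_eulerFactor _)
    have h3 : (0 : ℝ) ≤ N / Real.log N ^ 2 := by positivity
    have h4 : (N : ℝ) / Real.log N ^ 2 ≤ N / Real.log N ^ 2 * eulerFactor B₀ ^ 2 :=
      le_mul_of_one_le_right h3 h2
    rw [mul_div_assoc] at h1
    linarith
  have hsq1 : (1 : ℝ) ≤ √N := Real.one_le_sqrt.2 hN1.le
  calc (#{n ∈ range N | (α * (n : ℕ) + β).natAbs.Prime ∧ (γ * (n : ℕ) + δ).natAbs.Prime} : ℝ)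
      ≤ 4096 * (N / Real.log N ^ 2 * eulerFactor B₀ ^ 2) + 7 * √(N : ℝ) := by linarith
    _ ≤ (4096 + 112) * (N / Real.log N ^ 2 * eulerFactor B₀ ^ 2) := by linarith
    _ = _ := by ring

end

/-! ### Fourth moments of the Euler factor and Romanoff's lemma. -/

section

open Finset Filter Topology

theorem tendsto_primeCounting_two_pow_div :
    Tendsto (fun i : ℕ => (Nat.primeCounting (2 ^ (i + 1)) : ℝ) / 2 ^ i) atTop (𝓝 0) := by
  have h1 := Chebyshev.eventually_primeCounting_le one_pos
  have ht : Tendsto (fun i : ℕ => (2 : ℝ) ^ (i + 1)) atTop atTop :=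
    (tendsto_pow_atTop_atTop_of_one_lt one_lt_two).comp (tendsto_add_atTop_nat 1)
  have hlim : Tendsto (fun i : ℕ => 2 * (Real.log 4 + 1) / Real.log (2 ^ (i + 1))) atTop (𝓝 0) :=
    tendsto_const_nhds.div_atTop (Real.tendsto_log_atTop.comp ht)
  refine squeeze_zero' (Eventually.of_forall fun i => by positivity) ?_ hlim
  filter_upwards [ht.eventually h1] with i hi
  have : ⌊(2 : ℝ) ^ (i + 1)⌋₊ = 2 ^ (i + 1) := by
    exact_mod_cast Nat.floor_natCast (R := ℝ) (2 ^ (i + 1))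
  rw [this] at hi
  rw [div_le_iff₀ (by positivity)]
  refine hi.trans (le_of_eq ?_)
  rw [pow_succ]
  ring

theorem sum_inv_primes_two_pow_succ_le (i : ℕ) :
    ∑ p ∈ range (2 ^ (i + 1) + 1) with p.Prime, (p : ℝ)⁻¹ ≤
      ∑ p ∈ range (2 ^ i + 1) with p.Prime, (p : ℝ)⁻¹ +
        (Nat.primeCounting (2 ^ (i + 1)) : ℝ) / 2 ^ i := by
  have hsub : ({p ∈ range (2 ^ i + 1) | p.Prime} : Finset ℕ) ⊆
      {p ∈ range (2 ^ (i + 1) + 1) | p.Prime} := by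
    refine filter_subset_filter _ (range_subset_range.2 ?_)
    exact Nat.succ_le_succ (Nat.pow_le_pow_right two_pos (Nat.le_succ i))
  rw [← sum_sdiff hsub, add_comm]
  refine add_le_add_right ?_ _
  have hterm : ∀ p ∈ (range (2 ^ (i + 1) + 1)).filter Nat.Prime \
      (range (2 ^ i + 1)).filter Nat.Prime, (p : ℝ)⁻¹ ≤ (2 ^ i)⁻¹ := by
    intro p hp
    rw [Finset.mem_sdiff, mem_filter, mem_filter, mem_range, mem_range, not_and] at hp
    have : 2 ^ i ≤ p := by
      by_contra hcon
      exact hp.2 (by omega) hp.1.2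
    exact inv_anti₀ (by positivity) (by exact_mod_cast this)
  refine (sum_le_card_nsmul _ _ _ hterm).trans ?_
  rw [nsmul_eq_mul, div_eq_mul_inv]
  gcongr
  rw [← Nat.primesLE_card_eq_primeCounting]
  refine (card_le_card sdiff_subset).trans (card_le_card fun p hp => ?_)
  simp only [mem_filter, mem_range] at hp
  exact Nat.mem_primesLE.2 ⟨by omega, hp.2⟩

/-- A weak form of Mertens' theorem that suffices here: by Chebyshev the dyadic blocks of `∑ 1/p`
tend to 0, and there are `O(log M)` blocks. -/
theorem exists_sum_inv_primes_le {ε : ℝ} (hε : 0 < ε) :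
    ∃ C : ℝ, 0 ≤ C ∧ ∀ M : ℕ, 1 ≤ M →
      ∑ p ∈ range (M + 1) with p.Prime, (p : ℝ)⁻¹ ≤ C + ε * Real.log M := by
  have hev := tendsto_primeCounting_two_pow_div.eventually_lt_const (half_pos hε)
  obtain ⟨i₀, hi₀⟩ := eventually_atTop.1 hev
  set C₀ := ∑ p ∈ range (2 ^ i₀ + 1) with p.Prime, (p : ℝ)⁻¹ with hC₀
  have hpow : ∀ k, ∑ p ∈ range (2 ^ (i₀ + k) + 1) with p.Prime, (p : ℝ)⁻¹ ≤ C₀ + ε / 2 * k := by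
    intro k
    induction k with
    | zero => simp [hC₀]
    | succ k ih =>
      have h1 := sum_inv_primes_two_pow_succ_le (i₀ + k)
      have h2 := hi₀ (i₀ + k) (by omega)
      rw [← add_assoc]
      push_cast
      linarith
  refine ⟨C₀ + ε, by positivity, fun M hM => ?_⟩
  set k := Nat.log 2 M with hk
  have hk1 : M < 2 ^ (i₀ + (k + 1)) :=
    (Nat.lt_pow_succ_log_self one_lt_two M).trans_le (Nat.pow_le_pow_right two_pos (by omega))
  have hk2 : 2 ^ k ≤ M := Nat.pow_log_le_self 2 (by omega)
  have hmono : ∑ p ∈ range (M + 1) with p.Prime, (p : ℝ)⁻¹ ≤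
      ∑ p ∈ range (2 ^ (i₀ + (k + 1)) + 1) with p.Prime, (p : ℝ)⁻¹ := by
    refine sum_le_sum_of_subset_of_nonneg (filter_subset_filter _ (range_subset_range.2 ?_))
      fun _ _ _ => by positivity
    omega
  have hlog : (k : ℝ) / 2 ≤ Real.log M := by
    have h1 : Real.log ((2 : ℝ) ^ k) ≤ Real.log M :=
      Real.log_le_log (by positivity) (by exact_mod_cast hk2)
    rw [Real.log_pow] at h1
    have h2 := Real.log_two_gt_d9
    have h3 : (0 : ℝ) ≤ k := by positivity
    nlinarith
  have := hpow (k + 1)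
  push_cast at this
  nlinarith

/-- Primes up to `m²` are covered by the previous bound, where `ε = 1/120` yields `30 · 2 / 120 =
1/2`; the larger ones contribute at most `#S / m² ≤ 1` to `∑ 1/p`. Any exponent below 1 would serve,
since it is later set against `∑ m⁻²`. -/
theorem exists_prod_primes_le :
    ∃ C : ℝ, 0 < C ∧ ∀ (m : ℕ) (S : Finset ℕ), 1 ≤ m → (∀ p ∈ S, p.Prime) → #S ≤ m ^ 2 →
      ∏ p ∈ S, (1 + 30 * (p : ℝ)⁻¹) ≤ C * (m : ℝ) ^ (1 / 2 : ℝ) := by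
  obtain ⟨C, hC, h⟩ := exists_sum_inv_primes_le (ε := 1 / 120) (by norm_num)
  refine ⟨Real.exp (30 * (C + 1)), Real.exp_pos _, fun m S hm hS hcard => ?_⟩
  have hm0 : (0 : ℝ) < m := by exact_mod_cast hm
  have hsum : ∑ p ∈ S, (p : ℝ)⁻¹ ≤ C + 1 + 1 / 60 * Real.log m := by
    rw [← sum_filter_add_sum_filter_not S (· ≤ m ^ 2)]
    have h1 : ∑ p ∈ S with p ≤ m ^ 2, (p : ℝ)⁻¹ ≤ C + 1 / 60 * Real.log m := by
      have := h (m ^ 2) (Nat.one_le_pow _ _ hm)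
      push_cast at this
      rw [Real.log_pow] at this
      push_cast at this
      refine le_trans (sum_le_sum_of_subset_of_nonneg (fun p hp => ?_)
        fun _ _ _ => by positivity) (this.trans (by linarith))
      simp only [mem_filter, mem_range] at hp ⊢
      exact ⟨by omega, hS p hp.1⟩
    have h2 : ∑ p ∈ S with ¬ p ≤ m ^ 2, (p : ℝ)⁻¹ ≤ 1 := by
      have hterm : ∀ p ∈ S.filter (fun p => ¬ p ≤ m ^ 2), (p : ℝ)⁻¹ ≤ ((m : ℝ) ^ 2)⁻¹ := by
        intro p hp
        have := (mem_filter.1 hp).2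
        exact inv_anti₀ (by positivity) (by exact_mod_cast (not_le.1 this).le)
      refine (sum_le_card_nsmul _ _ _ hterm).trans ?_
      rw [nsmul_eq_mul, ← div_eq_mul_inv, div_le_one (by positivity)]
      exact_mod_cast (card_le_card (filter_subset _ _)).trans hcard
    linarith
  calc ∏ p ∈ S, (1 + 30 * (p : ℝ)⁻¹) ≤ ∏ p ∈ S, Real.exp (30 * (p : ℝ)⁻¹) := by
        refine prod_le_prod (fun _ _ => by positivity) fun p _ => ?_
        rw [add_comm]
        exact Real.add_one_le_exp _
    _ = Real.exp (30 * ∑ p ∈ S, (p : ℝ)⁻¹) := by rw [← Real.exp_sum, mul_sum]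
    _ ≤ Real.exp (30 * (C + 1) + 1 / 2 * Real.log m) := by
        refine Real.exp_le_exp.2 ?_
        linarith
    _ = Real.exp (30 * (C + 1)) * (m : ℝ) ^ (1 / 2 : ℝ) := by
        rw [Real.exp_add, Real.rpow_def_of_pos hm0, mul_comm (Real.log (m : ℝ))]

theorem inv_one_sub_inv_pow_four_le {p : ℕ} (hp : p.Prime) :
    ((1 - (p : ℝ)⁻¹)⁻¹) ^ 4 ≤ 1 + 30 * (p : ℝ)⁻¹ := by
  have h0 : 0 < (p : ℝ)⁻¹ := inv_pos.2 (by exact_mod_cast hp.pos)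
  have h1 : (p : ℝ)⁻¹ ≤ 2⁻¹ := inv_anti₀ two_pos (by exact_mod_cast hp.two_le)
  have h2 := one_sub_inv_prime_pos hp
  set u := (p : ℝ)⁻¹
  have h3 : ((1 - u)⁻¹) ^ 2 ≤ 1 + 6 * u := by
    rw [inv_pow, inv_le_iff_one_le_mul₀ (by positivity)]
    nlinarith [mul_nonneg h0.le (mul_nonneg (by linarith : 0 ≤ 1 / 2 - u)
      (by linarith : 0 ≤ 8 - 6 * u))]
  calc ((1 - u)⁻¹) ^ 4 = (((1 - u)⁻¹) ^ 2) ^ 2 := by ring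
    _ ≤ (1 + 6 * u) ^ 2 := by gcongr
    _ ≤ 1 + 30 * u := by nlinarith

theorem sum_eulerFactor_pow_four_le {X U : Finset ℕ} (f : ℕ → ℕ)
    (hU : ∀ d ∈ X, (f d).primeFactors ⊆ U) :
    ∑ d ∈ X, eulerFactor (f d) ^ 4 ≤ ∑ T ∈ U.powerset,
      (∏ p ∈ T, 30 * (p : ℝ)⁻¹) * #{d ∈ X | T ⊆ (f d).primeFactors} := by
  have h1 : ∀ d ∈ X, eulerFactor (f d) ^ 4 ≤
      ∑ T ∈ U.powerset, if T ⊆ (f d).primeFactors then ∏ p ∈ T, 30 * (p : ℝ)⁻¹ else 0 := by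
    intro d hd
    calc eulerFactor (f d) ^ 4 ≤ ∏ p ∈ (f d).primeFactors, (1 + 30 * (p : ℝ)⁻¹) := by
          rw [eulerFactor, ← prod_pow]
          refine prod_le_prod (fun p hp => ?_) fun p hp =>
            inv_one_sub_inv_pow_four_le (Nat.prime_of_mem_primeFactors hp)
          exact pow_nonneg (inv_nonneg.2
            (one_sub_inv_prime_pos (Nat.prime_of_mem_primeFactors hp)).le) _
      _ = _ := by
          rw [prod_one_add, ← sum_filter]
          refine sum_congr ?_ fun _ _ => rfl
          ext T
          simp only [mem_powerset, mem_filter]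
          exact ⟨fun h => ⟨h.trans (hU d hd), h⟩, fun h => h.2⟩
  refine (sum_le_sum h1).trans (le_of_eq ?_)
  rw [sum_comm]
  refine sum_congr rfl fun T _ => ?_
  rw [← sum_filter, sum_const, nsmul_eq_mul, mul_comm]

/-- After expansion over sets `T` of primes, at most `L / ∏ p` integers are divisible by all of `T`,
and `∏ (1 + 30 / p²)` converges. -/
theorem exists_sum_eulerFactor_pow_four_le :
    ∃ C : ℝ, 0 < C ∧ ∀ L : ℕ, ∑ d ∈ Icc 1 L, eulerFactor d ^ 4 ≤ C * L := by
  have hsum : Summable fun n : ℕ => ((n : ℝ) ^ 2)⁻¹ := Real.summable_nat_pow_inv.2 one_lt_two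
  refine ⟨Real.exp (30 * ∑' n : ℕ, ((n : ℝ) ^ 2)⁻¹), Real.exp_pos _, fun L => ?_⟩
  set U : Finset ℕ := {p ∈ range (L + 1) | p.Prime} with hU
  have hUp : ∀ p ∈ U, p.Prime := fun p hp => (mem_filter.1 hp).2
  have h1 := sum_eulerFactor_pow_four_le (X := Icc 1 L) (U := U) (fun d => d) (by
    intro d hd p hp
    rw [mem_Icc] at hd
    have := Nat.le_of_mem_primeFactors hp
    exact mem_filter.2 ⟨mem_range.2 (by omega), Nat.prime_of_mem_primeFactors hp⟩)
  refine h1.trans ?_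
  have h2 : ∀ T ∈ U.powerset, (∏ p ∈ T, 30 * (p : ℝ)⁻¹) *
      (#{d ∈ Icc 1 L | T ⊆ d.primeFactors} : ℝ) ≤ (∏ p ∈ T, 30 * ((p : ℝ) ^ 2)⁻¹) * L := by
    intro T hT
    have hTp : ∀ p ∈ T, p.Prime := fun p hp => hUp p (mem_powerset.1 hT hp)
    have hcard : (#{d ∈ Icc 1 L | T ⊆ d.primeFactors} : ℝ) ≤ L * ∏ p ∈ T, (p : ℝ)⁻¹ := by
      have hsub : {d ∈ Icc 1 L | T ⊆ d.primeFactors} ⊆ {d ∈ Ioc 0 L | (∏ p ∈ T, p) ∣ d} := by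
        intro d hd
        simp only [mem_filter, mem_Icc, mem_Ioc] at hd ⊢
        refine ⟨⟨by omega, hd.1.2⟩, prod_primes_dvd d (fun p hp => (hTp p hp).prime) fun p hp =>
          Nat.dvd_of_mem_primeFactors (hd.2 hp)⟩
      have h3 := card_le_card hsub
      rw [Nat.Ioc_filter_dvd_card_eq_div] at h3
      calc (#{d ∈ Icc 1 L | T ⊆ d.primeFactors} : ℝ) ≤ ((L / ∏ p ∈ T, p : ℕ) : ℝ) := by
            exact_mod_cast h3
        _ ≤ (L : ℝ) / ((∏ p ∈ T, p : ℕ) : ℝ) := Nat.cast_div_le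
        _ = _ := by
            push_cast
            rw [prod_inv_distrib, div_eq_mul_inv]
    calc _ ≤ (∏ p ∈ T, 30 * (p : ℝ)⁻¹) * (L * ∏ p ∈ T, (p : ℝ)⁻¹) := by
          gcongr
      _ = _ := by
          rw [mul_comm (L : ℝ), ← mul_assoc, ← prod_mul_distrib]
          congr 1
          refine prod_congr rfl fun p _ => ?_
          rw [sq, mul_inv]
          ring
  refine (sum_le_sum h2).trans ?_
  rw [← sum_mul, ← prod_one_add]
  refine mul_le_mul_of_nonneg_right ?_ (Nat.cast_nonneg _)
  calc ∏ p ∈ U, (1 + 30 * ((p : ℝ) ^ 2)⁻¹) ≤ ∏ p ∈ U, Real.exp (30 * ((p : ℝ) ^ 2)⁻¹) := by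
        refine prod_le_prod (fun _ _ => by positivity) fun p _ => ?_
        rw [add_comm]
        exact Real.add_one_le_exp _
    _ = Real.exp (30 * ∑ p ∈ U, ((p : ℝ) ^ 2)⁻¹) := by rw [← Real.exp_sum, mul_sum]
    _ ≤ _ := by
        gcongr
        exact hsum.sum_le_tsum _ fun _ _ => by positivity

theorem dvd_two_pow_sub_one_iff {p : ℕ} (d : ℕ) :
    p ∣ 2 ^ d - 1 ↔ orderOf (2 : ZMod p) ∣ d := by
  rw [orderOf_dvd_iff_pow_eq_one, ← ZMod.natCast_eq_zero_iff, Nat.cast_sub Nat.one_le_two_pow]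
  push_cast
  exact sub_eq_zero

theorem card_primeFactors_two_pow_sub_one_le (d : ℕ) : #(2 ^ d - 1).primeFactors ≤ d := by
  rcases eq_or_ne d 0 with rfl | hd
  · simp
  have h2 : 2 ≤ 2 ^ d := by
    calc 2 = 2 ^ 1 := rfl
      _ ≤ 2 ^ d := Nat.pow_le_pow_right two_pos (by omega)
  have h1 : 2 ^ #(2 ^ d - 1).primeFactors ≤ 2 ^ d - 1 :=
    (pow_card_le_prod _ _ _ fun p hp => (Nat.prime_of_mem_primeFactors hp).two_le).trans
      (Nat.le_of_dvd (by omega) (Nat.prod_primeFactors_dvd _))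
  exact (Nat.pow_lt_pow_iff_right one_lt_two).1 (h1.trans_lt (by omega)) |>.le

/-- Spreads `1/e` over the layers `m ≥ e`, so that a sum over sets with lcm exactly `e` can be
traded for sums over sets with lcm at most `m`. Telescoping gives `1/e - 1/(2L)`, which is at least
`1/(2e)` as `e ≤ L`. -/
theorem inv_le_two_mul_sum_Icc {e L : ℕ} (he : 1 ≤ e) (heL : e ≤ L) :
    (e : ℝ)⁻¹ ≤ 2 * ∑ m ∈ Icc 1 (2 * L) with e ≤ m, ((m : ℝ) ^ 2)⁻¹ := by
  have key : ∀ k : ℕ, (e : ℝ)⁻¹ - ((e + k : ℕ) : ℝ)⁻¹ ≤ ∑ m ∈ Ico e (e + k), ((m : ℝ) ^ 2)⁻¹ := by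
    intro k
    induction k with
    | zero => simp
    | succ k ih =>
      rw [← add_assoc, sum_Ico_succ_top (by omega)]
      have h0 : (0 : ℝ) < (e + k : ℕ) := by exact_mod_cast (by omega : 0 < e + k)
      have : ((e + k : ℕ) : ℝ)⁻¹ - ((e + k + 1 : ℕ) : ℝ)⁻¹ ≤ (((e + k : ℕ) : ℝ) ^ 2)⁻¹ := by
        push_cast at h0 ⊢
        rw [← sub_nonneg]
        have : (((e : ℝ) + k) ^ 2)⁻¹ - (((e : ℝ) + k)⁻¹ - ((e : ℝ) + k + 1)⁻¹) =
          (((e : ℝ) + k) ^ 2 * ((e : ℝ) + k + 1))⁻¹ := by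
          field_simp
          ring
        rw [this]
        positivity
      linarith
  have h := key (2 * L - e)
  rw [Nat.add_sub_cancel' (by omega : e ≤ 2 * L)] at h
  have he0 : (0 : ℝ) < e := by exact_mod_cast he
  have h2 : ((2 * L : ℕ) : ℝ)⁻¹ ≤ (e : ℝ)⁻¹ / 2 := by
    have : (e : ℝ) ≤ L := by exact_mod_cast heL
    push_cast
    rw [mul_inv, ← div_eq_inv_mul]
    have := inv_anti₀ he0 this
    linarith
  have h3 : ∑ m ∈ Ico e (2 * L), ((m : ℝ) ^ 2)⁻¹ ≤
      ∑ m ∈ Icc 1 (2 * L) with e ≤ m, ((m : ℝ) ^ 2)⁻¹ := by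
    refine sum_le_sum_of_subset_of_nonneg (fun m hm => ?_) fun _ _ _ => by positivity
    simp only [mem_Ico, mem_filter, mem_Icc] at hm ⊢
    omega
  linarith

theorem card_multiples_le {e : ℕ} (he : 1 ≤ e) (L : ℕ) :
    (#{d ∈ Ioc 0 L | e ∣ d} : ℝ) ≤
      L * (2 * ∑ m ∈ Icc 1 (2 * L) with e ≤ m, ((m : ℝ) ^ 2)⁻¹) := by
  rw [Nat.Ioc_filter_dvd_card_eq_div]
  by_cases heL : e ≤ L
  · refine (Nat.cast_div_le (α := ℝ)).trans ?_
    rw [div_eq_mul_inv]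
    exact mul_le_mul_of_nonneg_left (inv_le_two_mul_sum_Icc he heL) (Nat.cast_nonneg _)
  · rw [Nat.div_eq_of_lt (not_le.1 heL), Nat.cast_zero]
    exact mul_nonneg (Nat.cast_nonneg _) (mul_nonneg zero_le_two
      (sum_nonneg fun _ _ => by positivity))

/-- The fourth moment form of Romanoff's lemma, for a sequence `f` in which the prime `p` divides
exactly the terms whose index is a multiple of `o p`. -/
theorem exists_sum_eulerFactor_pow_four_le_of_dvd_iff {f o : ℕ → ℕ} (hf0 : ∀ d, 1 ≤ d → f d ≠ 0)
    (hfo : ∀ p d, p ∣ f d ↔ o p ∣ d) (hfc : ∀ d, #(f d).primeFactors ≤ d) :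
    ∃ C : ℝ, 0 < C ∧ ∀ L : ℕ, ∑ d ∈ Icc 1 L, eulerFactor (f d) ^ 4 ≤ C * L := by
  obtain ⟨C, hC, hprod⟩ := exists_prod_primes_le
  have hsum : Summable fun n : ℕ => ((n : ℝ) ^ (3 / 2 : ℝ))⁻¹ :=
    Real.summable_nat_rpow_inv.2 (by norm_num)
  have htsum : 0 ≤ ∑' n : ℕ, ((n : ℝ) ^ (3 / 2 : ℝ))⁻¹ := tsum_nonneg fun _ => by positivity
  refine ⟨2 * C * (∑' n : ℕ, ((n : ℝ) ^ (3 / 2 : ℝ))⁻¹ + 1), by positivity, fun L => ?_⟩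
  set U : Finset ℕ := (Icc 1 L).biUnion fun d => (f d).primeFactors with hU
  have hUp : ∀ p ∈ U, p.Prime := fun p hp => by
    obtain ⟨d, -, hd⟩ := mem_biUnion.1 hp
    exact Nat.prime_of_mem_primeFactors hd
  have hUo : ∀ p ∈ U, 0 < o p := fun p hp => by
    obtain ⟨d, hd, hpd⟩ := mem_biUnion.1 hp
    rw [mem_Icc] at hd
    exact Nat.pos_of_dvd_of_pos
      ((hfo _ d).1 (Nat.dvd_of_mem_primeFactors hpd)) (by omega)
  have h1 := sum_eulerFactor_pow_four_le (X := Icc 1 L) (U := U) f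
    fun d hd => subset_biUnion_of_mem (fun d => (f d).primeFactors) hd
  refine h1.trans ?_
  set a : Finset ℕ → ℝ := fun T => ∏ p ∈ T, 30 * (p : ℝ)⁻¹ with ha
  have ha0 : ∀ T, 0 ≤ a T := fun T => prod_nonneg fun _ _ => by positivity
  have hcount : ∀ T ∈ U.powerset, (#{d ∈ Icc 1 L | T ⊆ (f d).primeFactors} : ℝ) ≤
      L * (2 * ∑ m ∈ Icc 1 (2 * L) with T.lcm o ≤ m, ((m : ℝ) ^ 2)⁻¹) := by
    intro T hT
    have hTU := mem_powerset.1 hT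
    have he : 1 ≤ T.lcm o := Nat.pos_of_ne_zero fun h0 => by
      obtain ⟨p, hp, hp0⟩ := Finset.lcm_eq_zero_iff.1 h0
      exact (hUo p (hTU hp)).ne' hp0
    have hsub : {d ∈ Icc 1 L | T ⊆ (f d).primeFactors} ⊆ {d ∈ Ioc 0 L | T.lcm o ∣ d} := by
      intro d hd
      simp only [mem_filter, mem_Icc, mem_Ioc] at hd ⊢
      exact ⟨by omega, Finset.lcm_dvd fun p hp =>
        (hfo _ d).1 (Nat.dvd_of_mem_primeFactors (hd.2 hp))⟩
    exact (Nat.cast_le.2 (card_le_card hsub)).trans (card_multiples_le he L)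
  -- Such `T` consist of primes with `o p ≤ m`. Each divides one of `f 1, …, f m`, and `f d` has at
  -- most `d` prime factors, so at most `m²` primes are available.
  have hlayer : ∀ m ∈ Icc 1 (2 * L), ∑ T ∈ U.powerset with T.lcm o ≤ m, a T ≤
      C * (m : ℝ) ^ (1 / 2 : ℝ) := by
    intro m hm
    have hm1 := (mem_Icc.1 hm).1
    refine le_trans ?_ (hprod m {p ∈ U | o p ≤ m} hm1 (fun p hp => hUp p (mem_filter.1 hp).1) ?_)
    · rw [prod_one_add]
      refine sum_le_sum_of_subset_of_nonneg (fun T hT => ?_) fun T _ _ => ha0 T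
      simp only [mem_filter, mem_powerset] at hT ⊢
      intro p hp
      refine mem_filter.2 ⟨hT.1 hp, le_trans (Nat.le_of_dvd ?_ (Finset.dvd_lcm hp)) hT.2⟩
      refine Nat.pos_of_ne_zero fun h0 => ?_
      obtain ⟨q, hq, hq0⟩ := Finset.lcm_eq_zero_iff.1 h0
      exact (hUo q (hT.1 hq)).ne' hq0
    · have hsub : {p ∈ U | o p ≤ m} ⊆ (Icc 1 m).biUnion fun d => (f d).primeFactors := by
        intro p hp
        obtain ⟨hpU, hpm⟩ := mem_filter.1 hp
        have hop := hUo p hpU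
        refine mem_biUnion.2 ⟨o p, mem_Icc.2 ⟨hop, hpm⟩, Nat.mem_primeFactors.2 ⟨hUp p hpU,
          (hfo _ _).2 dvd_rfl, hf0 _ hop⟩⟩
      refine (card_le_card hsub).trans (card_biUnion_le.trans ?_)
      refine (sum_le_card_nsmul _ _ m fun d hd => ?_).trans ?_
      · exact (hfc d).trans (mem_Icc.1 hd).2
      · simp [sq]
  calc ∑ T ∈ U.powerset, a T * (#{d ∈ Icc 1 L | T ⊆ (f d).primeFactors} : ℝ)
      ≤ ∑ T ∈ U.powerset, a T * (L * (2 * ∑ m ∈ Icc 1 (2 * L) with T.lcm o ≤ m,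
          ((m : ℝ) ^ 2)⁻¹)) :=
        sum_le_sum fun T hT => mul_le_mul_of_nonneg_left (hcount T hT) (ha0 T)
    -- Interchanging the sums leaves `m⁻² · m^(1/2) = m^(-3/2)` in each layer, which is summable.
    _ = 2 * L * ∑ m ∈ Icc 1 (2 * L), ((m : ℝ) ^ 2)⁻¹ *
          ∑ T ∈ U.powerset with T.lcm o ≤ m, a T := by
        simp_rw [sum_filter, mul_sum]
        rw [sum_comm]
        refine sum_congr rfl fun m _ => sum_congr rfl fun T _ => ?_
        split_ifs <;> ring
    _ ≤ 2 * L * ∑ m ∈ Icc 1 (2 * L), C * ((m : ℝ) ^ (3 / 2 : ℝ))⁻¹ := by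
        refine mul_le_mul_of_nonneg_left (sum_le_sum fun m hm => ?_) (by positivity)
        have hm0 : (0 : ℝ) < m := by exact_mod_cast (mem_Icc.1 hm).1
        refine (mul_le_mul_of_nonneg_left (hlayer m hm) (by positivity)).trans (le_of_eq ?_)
        rw [← Real.rpow_neg hm0.le, ← Real.rpow_natCast, ← Real.rpow_neg hm0.le, mul_left_comm,
          ← Real.rpow_add hm0]
        norm_num
    _ ≤ 2 * L * (C * ∑' n : ℕ, ((n : ℝ) ^ (3 / 2 : ℝ))⁻¹) := by
        rw [← mul_sum]
        gcongr
        exact hsum.sum_le_tsum _ fun _ _ => by positivity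
    _ ≤ _ := by
        have : (0 : ℝ) ≤ L * C := by positivity
        nlinarith

/-- The fourth moment form of Romanoff's lemma. -/
theorem exists_sum_eulerFactor_two_pow_sub_one_le :
    ∃ C : ℝ, 0 < C ∧ ∀ L : ℕ, ∑ d ∈ Icc 1 L, eulerFactor (2 ^ d - 1) ^ 4 ≤ C * L :=
  exists_sum_eulerFactor_pow_four_le_of_dvd_iff (o := fun p => orderOf (2 : ZMod p))
    (fun d hd => by
      have := Nat.one_lt_two_pow (Nat.one_le_iff_ne_zero.1 hd)
      omega)
    (fun _ d => dvd_two_pow_sub_one_iff d) card_primeFactors_two_pow_sub_one_le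

end

/-! ### Cauchy-Schwarz, Chebyshev bounds, and prime solutions of `l q + h = l' q'`. -/

section

open Finset

theorem card_sq_le_card_image_mul_card_collisions {ι κ : Type*} [DecidableEq ι] [DecidableEq κ]
    (s : Finset ι) (f : ι → κ) :
    #s ^ 2 ≤ #(s.image f) * #{x ∈ s ×ˢ s | f x.1 = f x.2} := by
  have h1 : #s = ∑ b ∈ s.image f, #{a ∈ s | f a = b} :=
    card_eq_sum_card_fiberwise fun a ha => mem_image_of_mem f ha
  have h2 : #{x ∈ s ×ˢ s | f x.1 = f x.2} = ∑ b ∈ s.image f, #{a ∈ s | f a = b} ^ 2 := by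
    rw [card_eq_sum_card_fiberwise (f := fun x => f x.1) (t := s.image f)]
    · refine sum_congr rfl fun b _ => ?_
      rw [sq, ← card_product]
      congr 1
      ext x
      simp only [mem_filter, mem_product]
      constructor
      · rintro ⟨⟨⟨h1, h2⟩, h3⟩, h4⟩
        exact ⟨⟨h1, h4⟩, h2, h3 ▸ h4⟩
      · rintro ⟨⟨h1, h2⟩, h3, h4⟩
        exact ⟨⟨⟨h1, h3⟩, h2.trans h4.symm⟩, h2⟩
    · intro x hx
      have := (mem_filter.1 hx).1
      exact mem_image_of_mem f (mem_product.1 this).1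
  rw [h2]
  conv_lhs => rw [h1]
  exact sq_sum_le_card_mul_sum_sq

/-- Euler's argument: `log (z + 1)` is at most the harmonic sum, hence at most `∏ (1 - 1/p)⁻¹`, and
`(1 - u)⁻¹ ≤ 1 + 2u ≤ exp (2u)` for `0 ≤ u ≤ 1/2`. -/
theorem half_log_log_le_sum_inv_primes {z : ℕ} (hz : 1 ≤ z) :
    Real.log (Real.log ((z : ℝ) + 1)) / 2 ≤ ∑ p ∈ range (z + 1) with p.Prime, (p : ℝ)⁻¹ := by
  set S : Finset ℕ := {p ∈ range (z + 1) | p.Prime} with hS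
  have hSp : ∀ p ∈ S, p.Prime := fun p hp => (mem_filter.1 hp).2
  have h1 := sum_inv_le_prod_of_subset_factoredNumbers (S := S) (T := Icc 1 z) hSp
    fun n hn => by
      rw [mem_Icc] at hn
      refine Nat.mem_factoredNumbers_of_primeFactors_subset (by omega) fun p hp => ?_
      have := Nat.le_of_mem_primeFactors hp
      exact mem_filter.2 ⟨mem_range.2 (by omega), Nat.prime_of_mem_primeFactors hp⟩
  have h2 : Real.log ((z : ℝ) + 1) ≤ ∑ n ∈ Icc 1 z, (n : ℝ)⁻¹ := by
    have := log_add_one_le_harmonic z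
    rw [harmonic_eq_sum_Icc] at this
    push_cast at this
    exact_mod_cast this
  have h3 : ∏ p ∈ S, (1 - (p : ℝ)⁻¹)⁻¹ ≤ Real.exp (2 * ∑ p ∈ S, (p : ℝ)⁻¹) := by
    rw [mul_sum, Real.exp_sum]
    refine prod_le_prod (fun p hp => (inv_pos.2 (one_sub_inv_prime_pos (hSp p hp))).le)
      fun p hp => ?_
    have h0 : 0 < (p : ℝ)⁻¹ := inv_pos.2 (by exact_mod_cast (hSp p hp).pos)
    have h1 : (p : ℝ)⁻¹ ≤ 2⁻¹ := inv_anti₀ two_pos (by exact_mod_cast (hSp p hp).two_le)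
    have h4 := Real.add_one_le_exp (2 * (p : ℝ)⁻¹)
    refine le_trans ?_ h4
    rw [inv_le_iff_one_le_mul₀ (one_sub_inv_prime_pos (hSp p hp))]
    nlinarith
  have hz' : (1 : ℝ) ≤ z := by exact_mod_cast hz
  have hpos : 0 < Real.log ((z : ℝ) + 1) := Real.log_pos (by linarith)
  have h4 := Real.log_le_log hpos (h2.trans (h1.trans h3))
  rw [Real.log_exp] at h4
  linarith

theorem div_four_mul_log_le_primeCounting {n : ℕ} (hn : 4 ≤ n) :
    (n : ℝ) / (4 * Real.log n) ≤ Nat.primeCounting n := by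
  have hn' : (4 : ℝ) ≤ n := by exact_mod_cast hn
  have hlog : 0 < Real.log n := Real.log_pos (by linarith)
  refine le_trans ?_ (Chebyshev.pi_ge n)
  rw [div_le_div_iff₀ (by positivity) hlog]
  have h1 : Real.log ((n : ℝ) + 1) ≤ (n + 1) / 8 - 1 + 3 * Real.log 2 := by
    have h2 := Real.log_le_sub_one_of_pos (show (0 : ℝ) < (n + 1) / 8 by positivity)
    rw [Real.log_div (by positivity) (by norm_num), show (8 : ℝ) = 2 ^ 3 by norm_num,
      Real.log_pow] at h2
    push_cast at h2
    linarith
  have h3 := Real.log_two_gt_d9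
  have h4 := Real.log_two_lt_d9
  have h5 : (n : ℝ) ≤ 4 * (n * Real.log 2 - Real.log ((n : ℝ) + 1)) := by nlinarith
  nlinarith

theorem sieve_bound_rescale {C N N₁ w : ℝ} (hC : 0 ≤ C) (hN : 1 < N) (h1 : N₁ ≤ 2 * (N * w))
    (h2 : √N ≤ N₁) : C * N₁ / Real.log N₁ ^ 2 ≤ 8 * C * (N / Real.log N ^ 2 * w) := by
  have hlog : 0 < Real.log N := Real.log_pos hN
  have hs : 0 < √N := Real.sqrt_pos.2 (by linarith)
  have h3 : Real.log N / 2 ≤ Real.log N₁ := by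
    rw [← Real.log_sqrt (by linarith)]
    exact Real.log_le_log hs h2
  have h4 : 0 ≤ N * w := by linarith
  calc C * N₁ / Real.log N₁ ^ 2 ≤ C * (2 * (N * w)) / (Real.log N / 2) ^ 2 := by
        gcongr
    _ = _ := by
        field_simp
        ring

/-- The pairs of primes `(q, q')` with `l q + h = l' q'`. -/
def primeSolutions (N : ℕ) (h : ℤ) (l l' : ℕ) : Finset (ℕ × ℕ) :=
  {x ∈ range (N + 1) ×ˢ range (N + 1) |
    x.1.Prime ∧ x.2.Prime ∧ l * x.1 ≤ N ∧ (l : ℤ) * x.1 + h = l' * x.2}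

theorem sqrt_le_div_of_pow_four_le {N z m : ℕ} (hz : z ^ 4 ≤ N) (hm : 0 < m) (hmz : m ≤ z ^ 2) :
    √(N : ℝ) ≤ (N : ℝ) * (m : ℝ)⁻¹ := by
  have hm0 : (0 : ℝ) < m := by exact_mod_cast hm
  rw [← div_eq_mul_inv, le_div_iff₀ hm0]
  have h1 : (m : ℝ) ≤ √N := by
    refine Real.le_sqrt_of_sq_le ?_
    have : m ^ 2 ≤ N := by
      calc m ^ 2 ≤ (z ^ 2) ^ 2 := Nat.pow_le_pow_left hmz 2
        _ = z ^ 4 := by ring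
        _ ≤ N := hz
    exact_mod_cast this
  calc √(N : ℝ) * m ≤ √N * √N := by gcongr
    _ = N := Real.mul_self_sqrt (Nat.cast_nonneg N)

theorem div_add_one_bounds {N m : ℕ} (hm : 0 < m) (hmN : m ≤ N) :
    ((N / m + 1 : ℕ) : ℝ) ≤ 2 * ((N : ℝ) * (m : ℝ)⁻¹) ∧
      (N : ℝ) * (m : ℝ)⁻¹ ≤ ((N / m + 1 : ℕ) : ℝ) := by
  have hm0 : (0 : ℝ) < m := by exact_mod_cast hm
  rw [← div_eq_mul_inv]
  constructor
  · have h1 : ((N / m : ℕ) : ℝ) ≤ (N : ℝ) / m := Nat.cast_div_le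
    have h2 : 1 ≤ (N : ℝ) / m := (one_le_div hm0).2 (by exact_mod_cast hmN)
    push_cast
    linarith
  · rw [div_le_iff₀ hm0]
    exact_mod_cast (Nat.lt_mul_of_div_lt (Nat.lt_succ_self _) hm).le

/-- For `l ≠ l'` the solutions are `q = l' n + r`, `q' = l n + t` with `n ≤ N / (l l')` and
determinant `h`. For `l = l'` solvability forces `h = l k`, the equation becomes `q' = q + k`, and
the range is only cut to `N / l`. The condition `z ^ 4 ≤ N` keeps either range at least `√N` long,
so its logarithm is comparable to `log N`. -/
theorem exists_card_primeSolutions_le :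
    ∃ C : ℝ, 0 < C ∧ ∀ (N z l l' : ℕ) (h : ℤ), l.Prime → l'.Prime → l ≤ z → l' ≤ z →
      z ^ 4 ≤ N → h ≠ 0 → (#(primeSolutions N h l l') : ℝ) ≤
        C * (N / Real.log N ^ 2 * if l = l' then (l : ℝ)⁻¹ else ((l : ℝ) * l')⁻¹) *
          eulerFactor h.natAbs ^ 2 := by
  obtain ⟨C, hC, hsieve⟩ := exists_card_prime_two_forms_le
  refine ⟨128 * C, by positivity, fun N z l l' h hl hl' hlz hlz' hzN hh => ?_⟩
  have hz2 : 2 ≤ z := hl.two_le.trans hlz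
  have hzz : z ^ 2 ≤ N := (Nat.pow_le_pow_right (by omega) (by norm_num)).trans hzN
  have hN4 : 4 ≤ N := (Nat.pow_le_pow_left hz2 2).trans hzz
  have hN1 : (1 : ℝ) < N := by exact_mod_cast (by omega : 1 < N)
  have hpos : 0 < Real.log (N : ℝ) := Real.log_pos hN1
  have hF := eulerFactor_pos h.natAbs
  rcases (primeSolutions N h l l').eq_empty_or_nonempty with hemp | ⟨⟨q₀, q₀'⟩, h₀⟩
  · rw [hemp, card_empty, Nat.cast_zero]
    split_ifs <;> positivity
  simp only [primeSolutions, mem_filter, mem_product, mem_range] at h₀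
  obtain ⟨-, -, -, -, heq₀⟩ := h₀
  have hl0 : (l : ℤ) ≠ 0 := by exact_mod_cast hl.ne_zero
  have hl0' : (l' : ℤ) ≠ 0 := by exact_mod_cast hl'.ne_zero
  split_ifs with hll
  · subst hll
    set k : ℤ := q₀' - q₀ with hk
    have hhk : h = l * k := by rw [hk]; linear_combination heq₀
    have hk0 : k ≠ 0 := by
      intro hk0
      rw [hk0, mul_zero] at hhk
      exact hh hhk
    have hlN : l ≤ N := hlz.trans ((Nat.le_self_pow two_ne_zero z).trans hzz)
    obtain ⟨hb1, hb2⟩ := div_add_one_bounds hl.pos hlN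
    have hb3 := sqrt_le_div_of_pow_four_le hzN hl.pos (hlz.trans (Nat.le_self_pow two_ne_zero z))
    have hcard : #(primeSolutions N h l l) ≤ #{n ∈ range (N / l + 1) |
        ((1 : ℤ) * (n : ℕ) + 0).natAbs.Prime ∧ ((1 : ℤ) * (n : ℕ) + k).natAbs.Prime} := by
      have hsol : ∀ x ∈ primeSolutions N h l l, ((x.2 : ℤ) = x.1 + k) := by
        intro x hx
        have := (mem_filter.1 hx).2.2.2.2
        rw [hhk, ← mul_add] at this
        exact (mul_left_cancel₀ hl0 this).symm
      refine card_le_card_of_injOn Prod.fst (fun x hx => ?_) fun x hx y hy hxy => ?_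
      · have hx2 := hsol x hx
        simp only [primeSolutions, coe_filter, Set.mem_ofPred_eq] at hx
        simp only [coe_filter, Set.mem_ofPred_eq, mem_range, one_mul, add_zero, ← hx2,
          Int.natAbs_natCast]
        refine ⟨Nat.lt_succ_of_le ((Nat.le_div_iff_mul_le hl.pos).2 ?_), hx.2.1, hx.2.2.1⟩
        rw [mul_comm]
        exact hx.2.2.2.1
      · refine Prod.ext hxy ?_
        have h1 := hsol x hx
        have h2 := hsol y hy
        rw [hxy] at h1
        exact_mod_cast h1.trans h2.symm
    have h2 : 2 ≤ N / l + 1 := by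
      have := Nat.div_pos hlN hl.pos
      omega
    have hs := hsieve 1 0 1 k (N / l + 1) one_ne_zero one_ne_zero (by simpa using hk0) h2
    have hFk : eulerFactor ((1 : ℤ) * 1 * (1 * k - 0 * 1)).natAbs ≤ eulerFactor h.natAbs := by
      refine eulerFactor_mono ?_ (Int.natAbs_ne_zero.2 hh)
      rw [Int.natAbs_dvd_natAbs, hhk]
      simp
    have hFk0 := eulerFactor_pos ((1 : ℤ) * 1 * (1 * k - 0 * 1)).natAbs
    have hr := sieve_bound_rescale hC.le hN1 hb1 (hb3.trans hb2)
    calc (#(primeSolutions N h l l) : ℝ) ≤ _ := (Nat.cast_le.2 hcard).trans hs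
      _ ≤ 8 * C * (N / Real.log N ^ 2 * (l : ℝ)⁻¹) * eulerFactor h.natAbs ^ 2 := by
        gcongr
      _ ≤ _ := by
        gcongr
        norm_num
  -- The known solution is shifted down to `n = 0`, so that every solution corresponds to the
  -- natural number `q / l'`.
  · set r : ℕ := q₀ % l' with hr
    set t : ℤ := q₀' - l * (q₀ / l' : ℕ) with ht
    have hq₀ : (q₀ : ℤ) = l' * (q₀ / l' : ℕ) + r := by
      exact_mod_cast (Nat.div_add_mod q₀ l').symm
    have hrt : (l : ℤ) * r + h = l' * t := by
      rw [ht]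
      linear_combination heq₀ - l * hq₀
    have hm : 0 < l * l' := Nat.mul_pos hl.pos hl'.pos
    have hmz : l * l' ≤ z ^ 2 := by
      rw [sq]
      exact Nat.mul_le_mul hlz hlz'
    have hmN : l * l' ≤ N := hmz.trans hzz
    obtain ⟨hb1, hb2⟩ := div_add_one_bounds hm hmN
    have hb3 := sqrt_le_div_of_pow_four_le hzN hm hmz
    have hcop : IsCoprime (l' : ℤ) (l : ℤ) :=
      Nat.isCoprime_iff_coprime.2 ((Nat.coprime_primes hl' hl).2 fun h => hll h.symm)
    have hsol : ∀ x ∈ primeSolutions N h l l', x.1 = l' * (x.1 / l') + r ∧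
        (x.2 : ℤ) = l * (x.1 / l' : ℕ) + t := by
      intro x hx
      have heq := (mem_filter.1 hx).2.2.2.2
      have hdvd : (l' : ℤ) ∣ x.1 - r := by
        refine hcop.dvd_of_dvd_mul_left ⟨x.2 - t, ?_⟩
        linear_combination heq - hrt
      have hmod : x.1 % l' = r := by
        have h1 : (r : ℤ) ≡ x.1 [ZMOD l'] := Int.modEq_iff_dvd.2 hdvd
        have h2 : r ≡ x.1 [MOD l'] := Int.natCast_modEq_iff.1 h1
        rw [← h2, hr, Nat.mod_mod]
      have h1 : x.1 = l' * (x.1 / l') + r := by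
        rw [← hmod]
        exact (Nat.div_add_mod x.1 l').symm
      refine ⟨h1, mul_left_cancel₀ hl0' ?_⟩
      have h1' : (x.1 : ℤ) = l' * (x.1 / l' : ℕ) + r := by exact_mod_cast h1
      linear_combination hrt - heq + l * h1'
    have hcard : #(primeSolutions N h l l') ≤ #{n ∈ range (N / (l * l') + 1) |
        ((l' : ℤ) * (n : ℕ) + r).natAbs.Prime ∧ ((l : ℤ) * (n : ℕ) + t).natAbs.Prime} := by
      refine card_le_card_of_injOn (fun x => x.1 / l') (fun x hx => ?_) fun x hx y hy hxy => ?_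
      · obtain ⟨hx1, hx2⟩ := hsol x hx
        have hx1' : (l' : ℤ) * (x.1 / l' : ℕ) + r = (x.1 : ℕ) := by exact_mod_cast hx1.symm
        simp only [primeSolutions, coe_filter, Set.mem_ofPred_eq] at hx
        simp only [coe_filter, Set.mem_ofPred_eq, mem_range]
        rw [hx1', ← hx2, Int.natAbs_natCast, Int.natAbs_natCast, ← Nat.div_div_eq_div_mul]
        refine ⟨Nat.lt_succ_of_le (Nat.div_le_div_right ?_), hx.2.1, hx.2.2.1⟩
        rw [Nat.le_div_iff_mul_le hl.pos, mul_comm]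
        exact hx.2.2.2.1
      · obtain ⟨hx1, hx2⟩ := hsol x hx
        obtain ⟨hy1, hy2⟩ := hsol y hy
        change x.1 / l' = y.1 / l' at hxy
        rw [hxy] at hx1 hx2
        exact Prod.ext (hx1.trans hy1.symm) (by exact_mod_cast hx2.trans hy2.symm)
    have h2 : 2 ≤ N / (l * l') + 1 := by
      have := Nat.div_pos hmN hm
      omega
    have hdet : (l' : ℤ) * t - r * l = h := by linear_combination -hrt
    have hs := hsieve l' r l t (N / (l * l') + 1) hl0' hl0 (by rw [hdet]; exact hh) h2
    rw [hdet, Int.natAbs_mul, Int.natAbs_mul, Int.natAbs_natCast, Int.natAbs_natCast] at hs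
    have hFk : eulerFactor (l' * l * h.natAbs) ≤ 4 * eulerFactor h.natAbs := by
      have h1 := eulerFactor_mul_le (mul_ne_zero hl'.ne_zero hl.ne_zero)
        (Int.natAbs_ne_zero.2 hh)
      have h2 := eulerFactor_mul_le hl'.ne_zero hl.ne_zero
      have h3 := eulerFactor_prime_le hl
      have h4 := eulerFactor_prime_le hl'
      have h5 := eulerFactor_pos l
      have h6 := eulerFactor_pos l'
      refine h1.trans (mul_le_mul_of_nonneg_right (h2.trans ?_) hF.le)
      nlinarith
    have hFk0 := eulerFactor_pos (l' * l * h.natAbs)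
    have hr := sieve_bound_rescale hC.le hN1 hb1 (hb3.trans hb2)
    push_cast at hr hs
    calc (#(primeSolutions N h l l') : ℝ) ≤ _ := (Nat.cast_le.2 hcard).trans hs
      _ ≤ 8 * C * (N / Real.log N ^ 2 * ((l : ℝ) * l')⁻¹) * (4 * eulerFactor h.natAbs) ^ 2 := by
        gcongr
      _ = _ := by ring

theorem exists_card_prime_pairs_le :
    ∃ C : ℝ, 0 < C ∧ ∀ L d : ℕ, 2 ≤ L → 1 ≤ d →
      (#{p ∈ range (L + 1) | p.Prime ∧ (p + d).Prime} : ℝ) ≤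
        C * (L / Real.log L ^ 2) * eulerFactor d ^ 2 := by
  obtain ⟨C, hC, hsieve⟩ := exists_card_prime_two_forms_le
  refine ⟨2 * C, by positivity, fun L d hL hd => ?_⟩
  have hs := hsieve 1 0 1 d (L + 1) one_ne_zero one_ne_zero (by simpa using (by omega : d ≠ 0))
    (by omega)
  have hset : ({p ∈ range (L + 1) | p.Prime ∧ (p + d).Prime} : Finset ℕ) =
      {n ∈ range (L + 1) | ((1 : ℤ) * (n : ℕ) + 0).natAbs.Prime ∧
        ((1 : ℤ) * (n : ℕ) + d).natAbs.Prime} := by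
    refine filter_congr fun n _ => ?_
    rw [one_mul, add_zero, Int.natAbs_natCast, ← Nat.cast_add, Int.natAbs_natCast]
  rw [hset]
  refine hs.trans ?_
  have h1 : ((1 : ℤ) * 1 * (1 * d - 0 * 1)).natAbs = d := by simp
  rw [h1]
  have hL' : (2 : ℝ) ≤ L := by exact_mod_cast hL
  have hlog : 0 < Real.log (L : ℝ) := Real.log_pos (by linarith)
  have h2 : C * ((L + 1 : ℕ) : ℝ) / Real.log ((L + 1 : ℕ) : ℝ) ^ 2 ≤
      2 * C * (L / Real.log L ^ 2) := by
    calc C * ((L + 1 : ℕ) : ℝ) / Real.log ((L + 1 : ℕ) : ℝ) ^ 2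
        ≤ C * (2 * L) / Real.log L ^ 2 := by
          gcongr
          · push_cast; linarith
          · exact Nat.le_succ L
      _ = _ := by ring
  gcongr

end

/-! ### Counting the collisions. -/

section

open Finset Filter

theorem sum_offDiag_eq_two_mul {α : Type*} [LinearOrder α] (s : Finset α)
    (g : α → α → ℝ) (hg : ∀ a b, g a b = g b a) :
    ∑ x ∈ s.offDiag, g x.1 x.2 = 2 * ∑ x ∈ s ×ˢ s with x.1 < x.2, g x.1 x.2 := by
  have h1 : s.offDiag = {x ∈ s ×ˢ s | x.1 < x.2} ∪ {x ∈ s ×ˢ s | x.2 < x.1} := by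
    ext x
    simp only [mem_offDiag, mem_union, mem_filter, mem_product, ne_iff_lt_or_gt]
    tauto
  have h2 : Disjoint ({x ∈ s ×ˢ s | x.1 < x.2}) ({x ∈ s ×ˢ s | x.2 < x.1}) :=
    disjoint_filter.2 fun x _ h h' => lt_asymm h h'
  have h3 : ∑ x ∈ s ×ˢ s with x.2 < x.1, g x.1 x.2 = ∑ x ∈ s ×ˢ s with x.1 < x.2, g x.1 x.2 := by
    refine sum_nbij' Prod.swap Prod.swap ?_ ?_ ?_ ?_ ?_ <;>
      simp only [mem_filter, mem_product, Prod.fst_swap, Prod.snd_swap, Prod.swap_swap, implies_true]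
    · tauto
    · tauto
    · exact fun x _ => hg _ _
  rw [h1, sum_union h2, h3, two_mul]

theorem eulerFactor_two_pow_sub_le {a d : ℕ} (hd : 1 ≤ d) :
    eulerFactor ((2 : ℤ) ^ a - 2 ^ (a + d)).natAbs ≤ 2 * eulerFactor (2 ^ d - 1) := by
  have h1 : ((2 : ℤ) ^ a - 2 ^ (a + d)).natAbs = 2 ^ a * (2 ^ d - 1) := by
    rw [← Int.natAbs_neg]
    have : -((2 : ℤ) ^ a - 2 ^ (a + d)) = ((2 ^ a * (2 ^ d - 1) : ℕ) : ℤ) := by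
      rw [Nat.cast_mul, Nat.cast_sub Nat.one_le_two_pow]
      push_cast
      ring
    rw [this, Int.natAbs_natCast]
  have h2 : 2 ^ d - 1 ≠ 0 := by
    have := Nat.one_lt_two_pow (Nat.one_le_iff_ne_zero.1 hd)
    omega
  rw [h1]
  exact (eulerFactor_mul_le (by positivity) h2).trans
    (mul_le_mul_of_nonneg_right (eulerFactor_prime_pow_le Nat.prime_two a) (eulerFactor_pos _).le)

/-- Sort pairs by `d = p' - p > 0`. Up to sign, `2^p - 2^p'` is `2^p (2^d - 1)`, and the sieve bound
for prime pairs contributes `F(d)²`. The product of the two squares is at most the sum of fourth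
powers, whose averages over `d` are bounded. -/
theorem exists_sum_offDiag_eulerFactor_le :
    ∃ C : ℝ, 0 < C ∧ ∀ L : ℕ, 2 ≤ L →
      ∑ x ∈ ({p ∈ range (L + 1) | p.Prime} : Finset ℕ).offDiag,
        eulerFactor ((2 : ℤ) ^ x.1 - 2 ^ x.2).natAbs ^ 2 ≤ C * (L / Real.log L) ^ 2 := by
  obtain ⟨C₁, hC₁, hpairs⟩ := exists_card_prime_pairs_le
  obtain ⟨C₂, hC₂, hrom⟩ := exists_sum_eulerFactor_two_pow_sub_one_le
  obtain ⟨C₃, hC₃, hdiv⟩ := exists_sum_eulerFactor_pow_four_le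
  refine ⟨8 * C₁ * (C₂ + C₃), by positivity, fun L hL => ?_⟩
  have hL' : (2 : ℝ) ≤ L := by exact_mod_cast hL
  have hlog : 0 < Real.log (L : ℝ) := Real.log_pos (by linarith)
  set S : Finset ℕ := {p ∈ range (L + 1) | p.Prime} with hS
  rw [sum_offDiag_eq_two_mul S (fun a b => eulerFactor ((2 : ℤ) ^ a - 2 ^ b).natAbs ^ 2)
    fun a b => by rw [← Int.natAbs_neg ((2 : ℤ) ^ a - 2 ^ b), neg_sub]]
  have hmaps : ∀ x ∈ ({x ∈ S ×ˢ S | x.1 < x.2} : Finset (ℕ × ℕ)), x.2 - x.1 ∈ Icc 1 L := by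
    intro x hx
    simp only [hS, mem_filter, mem_product, mem_range] at hx
    rw [mem_Icc]
    omega
  have hfib : ∀ d ∈ Icc 1 L, ∑ x ∈ S ×ˢ S with x.1 < x.2 ∧ x.2 - x.1 = d,
      eulerFactor ((2 : ℤ) ^ x.1 - 2 ^ x.2).natAbs ^ 2 ≤
        4 * C₁ * (L / Real.log L ^ 2) * (eulerFactor (2 ^ d - 1) ^ 4 + eulerFactor d ^ 4) := by
    intro d hd
    have hd1 := (mem_Icc.1 hd).1
    have hF := eulerFactor_pos (2 ^ d - 1)
    have hcard : #{x ∈ S ×ˢ S | x.1 < x.2 ∧ x.2 - x.1 = d} ≤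
        #{p ∈ range (L + 1) | p.Prime ∧ (p + d).Prime} := by
      refine card_le_card_of_injOn Prod.fst (fun x hx => ?_) fun x hx y hy hxy => ?_
      · simp only [hS, coe_filter, mem_filter, mem_product, Set.mem_ofPred_eq] at hx ⊢
        have : x.1 + d = x.2 := by omega
        rw [this]
        exact ⟨hx.1.1.1, hx.1.1.2, hx.1.2.2⟩
      · simp only [coe_filter, Set.mem_ofPred_eq] at hx hy
        exact Prod.ext hxy (by omega)
    have hterm : ∀ x ∈ ({x ∈ S ×ˢ S | x.1 < x.2 ∧ x.2 - x.1 = d} : Finset (ℕ × ℕ)),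
        eulerFactor ((2 : ℤ) ^ x.1 - 2 ^ x.2).natAbs ^ 2 ≤ 4 * eulerFactor (2 ^ d - 1) ^ 2 := by
      intro x hx
      have hx' := (mem_filter.1 hx).2
      have : x.2 = x.1 + d := by omega
      rw [this]
      have h1 := eulerFactor_two_pow_sub_le (a := x.1) hd1
      have h2 := eulerFactor_pos ((2 : ℤ) ^ x.1 - 2 ^ (x.1 + d)).natAbs
      calc _ ≤ (2 * eulerFactor (2 ^ d - 1)) ^ 2 := by gcongr
        _ = _ := by ring
    refine (sum_le_card_nsmul _ _ _ hterm).trans ?_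
    rw [nsmul_eq_mul]
    have hp := (Nat.cast_le (α := ℝ).2 hcard).trans (hpairs L d hL hd1)
    calc _ ≤ C₁ * (L / Real.log L ^ 2) * eulerFactor d ^ 2 * (4 * eulerFactor (2 ^ d - 1) ^ 2) := by
          gcongr
      _ = 4 * C₁ * (L / Real.log L ^ 2) * (eulerFactor (2 ^ d - 1) ^ 2 * eulerFactor d ^ 2) := by
          ring
      _ ≤ _ := by
          gcongr
          nlinarith [sq_nonneg (eulerFactor (2 ^ d - 1) ^ 2 - eulerFactor d ^ 2),
            sq_nonneg (eulerFactor (2 ^ d - 1) ^ 2), sq_nonneg (eulerFactor d ^ 2)]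
  rw [← sum_fiberwise_of_maps_to hmaps]
  simp_rw [filter_filter]
  calc _ ≤ 2 * ∑ d ∈ Icc 1 L, 4 * C₁ * (L / Real.log L ^ 2) *
        (eulerFactor (2 ^ d - 1) ^ 4 + eulerFactor d ^ 4) := by
        gcongr with d hd
        exact hfib d hd
    _ ≤ 2 * (4 * C₁ * (L / Real.log L ^ 2) * (C₂ * L + C₃ * L)) := by
        rw [← mul_sum, sum_add_distrib]
        gcongr
        · exact hrom L
        · exact hdiv L
    _ = _ := by
        field_simp
        ring

/-- The pairs of primes `(l, q)` with `l ≤ z < q` and `2 l q ≤ N`. -/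
def primeFactorPairs (N z : ℕ) : Finset (ℕ × ℕ) :=
  {x ∈ range (z + 1) ×ˢ range (N + 1) |
    x.1.Prime ∧ x.2.Prime ∧ z < x.2 ∧ 2 * (x.1 * x.2) ≤ N}

/-- The collisions `2 ^ p + l q = 2 ^ p' + l' q'` with `p ≠ p'`, counted by `p, p', l, l'`. -/
theorem card_collisions_le (N z : ℕ) (S : Finset ℕ) :
    #{x ∈ (S ×ˢ primeFactorPairs N z) ×ˢ (S ×ˢ primeFactorPairs N z) |
        2 ^ x.1.1 + x.1.2.1 * x.1.2.2 = 2 ^ x.2.1 + x.2.2.1 * x.2.2.2} ≤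
      #(S ×ˢ primeFactorPairs N z) +
      ∑ x ∈ S.offDiag, ∑ y ∈ ({l ∈ range (z + 1) | l.Prime} : Finset ℕ) ×ˢ
        ({l ∈ range (z + 1) | l.Prime} : Finset ℕ),
        #(primeSolutions N ((2 : ℤ) ^ x.1 - 2 ^ x.2) y.1 y.2) := by
  set Ω := S ×ˢ primeFactorPairs N z with hΩ
  set Λ : Finset ℕ := {l ∈ range (z + 1) | l.Prime} with hΛ
  set K := {x ∈ Ω ×ˢ Ω | 2 ^ x.1.1 + x.1.2.1 * x.1.2.2 = 2 ^ x.2.1 + x.2.2.1 * x.2.2.2} with hK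
  have hΩmem : ∀ x ∈ Ω, x.1 ∈ S ∧ x.2.1 ≤ z ∧ x.2.1.Prime ∧ x.2.2.Prime ∧ z < x.2.2 ∧
      x.2.2 ≤ N ∧ 2 * (x.2.1 * x.2.2) ≤ N := by
    intro x hx
    simp only [hΩ, primeFactorPairs, mem_product, mem_filter, mem_range] at hx
    obtain ⟨h1, ⟨h2, h3⟩, h4, h5, h6, h7⟩ := hx
    exact ⟨h1, by omega, h4, h5, h6, by omega, h7⟩
  rw [← card_filter_add_card_filter_not (s := K) (fun x => x.1.1 = x.2.1)]
  refine Nat.add_le_add ?_ ?_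
  · refine card_le_card_of_injOn Prod.fst (fun x hx => ?_) fun x hx y hy hxy => ?_
    · exact (mem_product.1 (mem_filter.1 (mem_filter.1 hx).1).1).1
    · have key : ∀ x ∈ K.filter (fun x => x.1.1 = x.2.1), x.1 = x.2 := by
        intro x hx
        obtain ⟨hx1, hpp⟩ := mem_filter.1 hx
        obtain ⟨hx2, heq⟩ := mem_filter.1 hx1
        obtain ⟨hx3, hx4⟩ := mem_product.1 hx2
        obtain ⟨-, hz1, hl1, hq1, hzq1, -, -⟩ := hΩmem _ hx3
        obtain ⟨-, hz2, hl2, hq2, hzq2, -, -⟩ := hΩmem _ hx4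
        rw [hpp] at heq
        have heq' : x.1.2.1 * x.1.2.2 = x.2.2.1 * x.2.2.2 := Nat.add_left_cancel heq
        have hdvd : x.2.2.1 ∣ x.1.2.1 * x.1.2.2 := heq' ▸ dvd_mul_right _ _
        -- The alternative, the small prime on one side equal to the large prime on the other,
        -- contradicts `l ≤ z < q`.
        have hll : x.2.2.1 = x.1.2.1 := by
          rcases (hl2.dvd_mul).1 hdvd with h | h
          · exact (Nat.prime_dvd_prime_iff_eq hl2 hl1).1 h
          · have := (Nat.prime_dvd_prime_iff_eq hl2 hq1).1 h
            omega
        rw [hll] at heq'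
        exact Prod.ext hpp (Prod.ext hll.symm (Nat.eq_of_mul_eq_mul_left hl1.pos heq'))
      have hx' := key x hx
      have hy' := key y hy
      exact Prod.ext hxy (by rw [← hx', ← hy', hxy])
  · rw [← sum_product' S.offDiag (Λ ×ˢ Λ)
      (fun x y => #(primeSolutions N ((2 : ℤ) ^ x.1 - 2 ^ x.2) y.1 y.2))]
    -- Fixing `p, p', l, l'` leaves the pair `(q, q')`, which lies in `primeSolutions`.
    rw [card_eq_sum_card_fiberwise (t := S.offDiag ×ˢ (Λ ×ˢ Λ))
      (f := fun x => ((x.1.1, x.2.1), (x.1.2.1, x.2.2.1)))]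
    · refine sum_le_sum fun b _ => ?_
      refine card_le_card_of_injOn (fun x => (x.1.2.2, x.2.2.2)) (fun x hx => ?_)
        fun x hx y hy hxy => ?_
      · obtain ⟨hx0, hb⟩ := mem_filter.1 hx
        obtain ⟨hx1, hpp⟩ := mem_filter.1 hx0
        obtain ⟨hx2, heq⟩ := mem_filter.1 hx1
        obtain ⟨hx3, hx4⟩ := mem_product.1 hx2
        obtain ⟨-, hz1, hl1, hq1, hzq1, hN1, hlq1⟩ := hΩmem _ hx3
        obtain ⟨-, hz2, hl2, hq2, hzq2, hN2, hlq2⟩ := hΩmem _ hx4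
        subst hb
        refine mem_filter.2 ⟨mem_product.2 ⟨mem_range.2 (Nat.lt_succ_of_le hN1),
          mem_range.2 (Nat.lt_succ_of_le hN2)⟩, hq1, hq2, ?_, ?_⟩
        · change x.1.2.1 * x.1.2.2 ≤ N
          omega
        · have heq' : (2 : ℤ) ^ x.1.1 + x.1.2.1 * x.1.2.2 = 2 ^ x.2.1 + x.2.2.1 * x.2.2.2 := by
            exact_mod_cast heq
          change (x.1.2.1 : ℤ) * x.1.2.2 + (2 ^ x.1.1 - 2 ^ x.2.1) = x.2.2.1 * x.2.2.2
          linear_combination heq'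
      · have hx' := (mem_filter.1 hx).2
        have hy' := (mem_filter.1 hy).2
        have h := hx'.trans hy'.symm
        simp only [Prod.mk.injEq] at h hxy
        obtain ⟨⟨h1, h2⟩, h3, h4⟩ := h
        obtain ⟨h5, h6⟩ := hxy
        exact Prod.ext (Prod.ext h1 (Prod.ext h3 h5)) (Prod.ext h2 (Prod.ext h4 h6))
    · intro x hx
      obtain ⟨hx1, hpp⟩ := mem_filter.1 hx
      obtain ⟨hx2, -⟩ := mem_filter.1 hx1
      obtain ⟨hx3, hx4⟩ := mem_product.1 hx2
      obtain ⟨hS1, hz1, hl1, -⟩ := hΩmem _ hx3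
      obtain ⟨hS2, hz2, hl2, -⟩ := hΩmem _ hx4
      refine mem_product.2 ⟨mem_offDiag.2 ⟨hS1, hS2, hpp⟩, mem_product.2
        ⟨mem_filter.2 ⟨mem_range.2 (Nat.lt_succ_of_le hz1), hl1⟩,
          mem_filter.2 ⟨mem_range.2 (Nat.lt_succ_of_le hz2), hl2⟩⟩⟩

theorem sum_product_ite_inv_le (Λ : Finset ℕ) :
    ∑ y ∈ Λ ×ˢ Λ, (if y.1 = y.2 then (y.1 : ℝ)⁻¹ else ((y.1 : ℝ) * y.2)⁻¹) ≤
      (∑ l ∈ Λ, (l : ℝ)⁻¹) ^ 2 + ∑ l ∈ Λ, (l : ℝ)⁻¹ := by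
  have h1 : ∀ y ∈ Λ ×ˢ Λ, (if y.1 = y.2 then (y.1 : ℝ)⁻¹ else ((y.1 : ℝ) * y.2)⁻¹) ≤
      (y.1 : ℝ)⁻¹ * (y.2 : ℝ)⁻¹ + if y.1 = y.2 then (y.1 : ℝ)⁻¹ else 0 := by
    intro y _
    split_ifs
    · have : 0 ≤ (y.1 : ℝ)⁻¹ * (y.2 : ℝ)⁻¹ := by positivity
      linarith
    · rw [mul_inv, add_zero]
  refine (sum_le_sum h1).trans (le_of_eq ?_)
  rw [sum_add_distrib, sq, sum_mul_sum, ← sum_product', sum_product (f := fun y : ℕ × ℕ =>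
    if y.1 = y.2 then (y.1 : ℝ)⁻¹ else 0)]
  congr 1
  refine sum_congr rfl fun a ha => ?_
  rw [sum_ite_eq, if_pos ha]

/-- The number of collisions with distinct exponents. -/
theorem exists_sum_card_primeSolutions_le :
    ∃ C : ℝ, 0 < C ∧ ∀ N z L : ℕ, 2 ≤ L → z ^ 4 ≤ N →
      ((∑ x ∈ ({p ∈ range (L + 1) | p.Prime} : Finset ℕ).offDiag,
        ∑ y ∈ ({l ∈ range (z + 1) | l.Prime} : Finset ℕ) ×ˢ
          ({l ∈ range (z + 1) | l.Prime} : Finset ℕ),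
          #(primeSolutions N ((2 : ℤ) ^ x.1 - 2 ^ x.2) y.1 y.2) : ℕ) : ℝ) ≤
        C * (N / Real.log N ^ 2) * (L / Real.log L) ^ 2 *
          ((∑ l ∈ range (z + 1) with l.Prime, (l : ℝ)⁻¹) ^ 2 +
            ∑ l ∈ range (z + 1) with l.Prime, (l : ℝ)⁻¹) := by
  obtain ⟨C₁, hC₁, hsol⟩ := exists_card_primeSolutions_le
  obtain ⟨C₂, hC₂, hoff⟩ := exists_sum_offDiag_eulerFactor_le
  refine ⟨C₁ * C₂, by positivity, fun N z L hL hz => ?_⟩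
  set S : Finset ℕ := {p ∈ range (L + 1) | p.Prime} with hS
  set Λ : Finset ℕ := {l ∈ range (z + 1) | l.Prime} with hΛ
  push_cast
  have hmem : ∀ l ∈ Λ, l.Prime ∧ l ≤ z := fun l hl => by
    simp only [hΛ, mem_filter, mem_range] at hl
    exact ⟨hl.2, by omega⟩
  have h1 : ∀ x ∈ S.offDiag, ∑ y ∈ Λ ×ˢ Λ,
      (#(primeSolutions N ((2 : ℤ) ^ x.1 - 2 ^ x.2) y.1 y.2) : ℝ) ≤
        C₁ * (N / Real.log N ^ 2) * ((∑ l ∈ Λ, (l : ℝ)⁻¹) ^ 2 + ∑ l ∈ Λ, (l : ℝ)⁻¹) *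
          eulerFactor ((2 : ℤ) ^ x.1 - 2 ^ x.2).natAbs ^ 2 := by
    intro x hx
    have hne : (2 : ℤ) ^ x.1 - 2 ^ x.2 ≠ 0 := by
      intro h
      have h' : (2 : ℤ) ^ x.1 = 2 ^ x.2 := sub_eq_zero.1 h
      have h2 : (2 : ℕ) ^ x.1 = 2 ^ x.2 := by exact_mod_cast h'
      exact (mem_offDiag.1 hx).2.2 (Nat.pow_right_injective le_rfl h2)
    calc _ ≤ ∑ y ∈ Λ ×ˢ Λ, C₁ * (N / Real.log N ^ 2) *
          eulerFactor ((2 : ℤ) ^ x.1 - 2 ^ x.2).natAbs ^ 2 *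
          (if y.1 = y.2 then (y.1 : ℝ)⁻¹ else ((y.1 : ℝ) * y.2)⁻¹) := by
          refine sum_le_sum fun y hy => ?_
          obtain ⟨hy1, hy2⟩ := mem_product.1 hy
          refine (hsol N z y.1 y.2 _ (hmem _ hy1).1 (hmem _ hy2).1 (hmem _ hy1).2 (hmem _ hy2).2
            hz hne).trans (le_of_eq ?_)
          ring
      _ ≤ C₁ * (N / Real.log N ^ 2) * eulerFactor ((2 : ℤ) ^ x.1 - 2 ^ x.2).natAbs ^ 2 *
          ((∑ l ∈ Λ, (l : ℝ)⁻¹) ^ 2 + ∑ l ∈ Λ, (l : ℝ)⁻¹) := by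
          rw [← mul_sum]
          exact mul_le_mul_of_nonneg_left (sum_product_ite_inv_le Λ) (by positivity)
      _ = _ := by ring
  refine (sum_le_sum h1).trans ?_
  rw [← mul_sum]
  have h0 : 0 ≤ ∑ l ∈ Λ, (l : ℝ)⁻¹ := sum_nonneg fun _ _ => by positivity
  calc _ ≤ C₁ * (N / Real.log N ^ 2) * ((∑ l ∈ Λ, (l : ℝ)⁻¹) ^ 2 + ∑ l ∈ Λ, (l : ℝ)⁻¹) *
        (C₂ * (L / Real.log L) ^ 2) :=
        mul_le_mul_of_nonneg_left (hoff L hL) (by positivity)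
    _ = _ := by ring

end

/-! ### Choice of parameters and conclusion. -/

open Finset Filter

theorem two_mul_mul_primeCounting_bound {N l : ℕ} (hl : 1 ≤ l) (hN : 8 * l ≤ N) :
    (N : ℝ) / (16 * Real.log N) * (l : ℝ)⁻¹ ≤ Nat.primeCounting (N / (2 * l)) := by
  set y := N / (2 * l) with hy
  have hy4 : 4 ≤ y := by
    rw [hy, Nat.le_div_iff_mul_le (by omega)]
    omega
  have hyN : y ≤ N := Nat.div_le_self _ _
  have hl0 : (0 : ℝ) < l := by exact_mod_cast hl
  have hy4' : (4 : ℝ) ≤ y := by exact_mod_cast hy4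
  have hlogy : 0 < Real.log y := Real.log_pos (by linarith)
  have hlog : Real.log y ≤ Real.log N := Real.log_le_log (by linarith) (by exact_mod_cast hyN)
  have hbig : (N : ℝ) ≤ 4 * l * y := by
    have h1 : N < (y + 1) * (2 * l) := by
      rw [mul_comm]
      exact Nat.lt_mul_div_succ N (by omega)
    have h2 : N ≤ 4 * l * y := by nlinarith
    exact_mod_cast h2
  refine le_trans ?_ (div_four_mul_log_le_primeCounting hy4)
  calc (N : ℝ) / (16 * Real.log N) * (l : ℝ)⁻¹ ≤ (4 * l * y) / (16 * Real.log y) * (l : ℝ)⁻¹ := by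
        gcongr
    _ = _ := by
        field_simp
        norm_num

/-- For each `l`, the prime `q` runs over `(z, N / (2l)]`. The condition `32 log N ≤ √N` ensures
that discarding the primes up to `z` costs at most half of the Chebyshev bound. -/
theorem le_card_primeFactorPairs {N z : ℕ} (hz : z ^ 4 ≤ N) (hz2 : 4 ≤ z)
    (hlog : 32 * Real.log N ≤ √N) :
    (N : ℝ) / (32 * Real.log N) * ∑ l ∈ range (z + 1) with l.Prime, (l : ℝ)⁻¹ ≤
      #(primeFactorPairs N z) := by
  set Λ : Finset ℕ := {l ∈ range (z + 1) | l.Prime} with hΛ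
  have hzN : z ^ 2 ≤ N := (Nat.pow_le_pow_right (by omega) (by norm_num)).trans hz
  have hN : 16 ≤ N := (Nat.pow_le_pow_left hz2 2).trans hzN
  have hlogpos : 0 < Real.log N := Real.log_pos (by exact_mod_cast (by omega : 1 < N))
  have hzsq : (z : ℝ) ^ 2 ≤ √N := by
    refine Real.le_sqrt_of_sq_le ?_
    rw [← pow_mul]
    exact_mod_cast hz
  have hmaps : ∀ x ∈ primeFactorPairs N z, x.1 ∈ Λ := by
    intro x hx
    simp only [primeFactorPairs, mem_filter, mem_product] at hx
    exact mem_filter.2 ⟨hx.1.1, hx.2.1⟩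
  rw [card_eq_sum_card_fiberwise hmaps, mul_sum]
  push_cast
  refine sum_le_sum fun l hl => ?_
  have hlp : l.Prime := (mem_filter.1 hl).2
  have hlz : l ≤ z := by
    have := mem_range.1 (mem_filter.1 hl).1
    omega
  have hl0 : (0 : ℝ) < l := by exact_mod_cast hlp.pos
  have h8 : 8 * l ≤ N := by
    have h1 : z ^ 4 = z * z * (z * z) := by ring
    have h2 : 16 ≤ z * z := Nat.mul_le_mul hz2 hz2
    nlinarith
  have hsub : (Nat.primesLE (N / (2 * l)) \ Icc 1 z).image (fun q => (l, q)) ⊆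
      {x ∈ primeFactorPairs N z | x.1 = l} := by
    intro x hx
    obtain ⟨q, hq, rfl⟩ := mem_image.1 hx
    rw [Finset.mem_sdiff, Nat.mem_primesLE, mem_Icc] at hq
    obtain ⟨⟨hq1, hq2⟩, hq3⟩ := hq
    have hqpos := hq2.pos
    have hqle : q * (2 * l) ≤ N := (Nat.le_div_iff_mul_le (Nat.mul_pos two_pos hlp.pos)).1 hq1
    simp only [primeFactorPairs, mem_filter, mem_product, mem_range, and_true]
    have hqN : q ≤ N := hq1.trans (Nat.div_le_self _ _)
    have hqz : z < q := by
      by_contra hcon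
      exact hq3 ⟨hqpos, not_lt.1 hcon⟩
    exact ⟨⟨Nat.lt_succ_of_le hlz, Nat.lt_succ_of_le hqN⟩, hlp, hq2, hqz, by linarith⟩
  have hcard := card_le_card hsub
  rw [card_image_of_injective _ (fun a b h => (Prod.mk.inj h).2)] at hcard
  have hcard2 := (le_card_sdiff (Icc 1 z) (Nat.primesLE (N / (2 * l)))).trans hcard
  rw [Nat.primesLE_card_eq_primeCounting, Nat.card_Icc, Nat.add_sub_cancel] at hcard2
  have hcard3 : (Nat.primeCounting (N / (2 * l)) : ℝ) ≤
      #{x ∈ primeFactorPairs N z | x.1 = l} + z := by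
    exact_mod_cast Nat.sub_le_iff_le_add.1 hcard2
  have hpi := two_mul_mul_primeCounting_bound hlp.one_le h8
  have hzle : (z : ℝ) ≤ (N : ℝ) / (32 * Real.log N) * (l : ℝ)⁻¹ := by
    rw [← div_eq_mul_inv, div_div, le_div_iff₀ (by positivity)]
    have hlz' : (l : ℝ) ≤ z := by exact_mod_cast hlz
    calc (z : ℝ) * (32 * Real.log N * l) ≤ z * (32 * Real.log N * z) := by gcongr
      _ = 32 * Real.log N * z ^ 2 := by ring
      _ ≤ √N * √N := by gcongr
      _ = N := Real.mul_self_sqrt (Nat.cast_nonneg N)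
  have h16 : (N : ℝ) / (16 * Real.log N) * (l : ℝ)⁻¹ =
      2 * ((N : ℝ) / (32 * Real.log N) * (l : ℝ)⁻¹) := by
    field_simp
    norm_num
  linarith

/-- Closes the second moment argument with `t = W / log L`. If `M` dominates, then `A ≥ M / 2 ≥ N /
2048`; otherwise `t²` cancels and `A ≥ N / (2 · 256² · D)`, so no upper bound on `t` is needed. -/
theorem min_mul_le_of_sq_le {A M N D t : ℝ} (hN : 0 < N) (hD : 0 < D) (ht : 1 / 4 ≤ t)
    (hM : N * t / 256 ≤ M) (h : M ^ 2 ≤ A * (M + D * N * t ^ 2)) :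
    min (1 / 2048) (1 / (131072 * D)) * N ≤ A := by
  have ht0 : 0 < t := by linarith
  have hM0 : 0 < M := lt_of_lt_of_le (by positivity) hM
  have hA : 0 < A := by
    by_contra hcon
    have h1 : 0 < M + D * N * t ^ 2 := by positivity
    nlinarith [mul_nonneg (neg_nonneg.2 (not_lt.1 hcon)) h1.le, pow_pos hM0 2]
  rcases le_total (D * N * t ^ 2) M with hle | hle
  · have h1 : M * M ≤ 2 * A * M := by nlinarith
    have h2 : M ≤ 2 * A := le_of_mul_le_mul_right h1 hM0
    calc min (1 / 2048) (1 / (131072 * D)) * N ≤ 1 / 2048 * N := by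
          gcongr
          exact min_le_left _ _
      _ ≤ A := by nlinarith
  · have h1 : (N * t / 256) ^ 2 ≤ A * (2 * (D * N * t ^ 2)) := by
      calc (N * t / 256) ^ 2 ≤ M ^ 2 := by gcongr
        _ ≤ A * (M + D * N * t ^ 2) := h
        _ ≤ _ := by gcongr; linarith
    have h2 : (N * t ^ 2) * N ≤ (N * t ^ 2) * (131072 * D * A) := by nlinarith
    have h3 : N ≤ 131072 * D * A := le_of_mul_le_mul_left h2 (by positivity)
    calc min (1 / 2048) (1 / (131072 * D)) * N ≤ 1 / (131072 * D) * N := by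
          gcongr
          exact min_le_right _ _
      _ ≤ A := by
          rw [one_div, inv_mul_le_iff₀ (by positivity)]
          exact h3

theorem exists_mul_le_card_image :
    ∃ c : ℝ, 0 < c ∧ ∀ᶠ N : ℕ in atTop, ∃ L z : ℕ, 2 ^ (L + 1) ≤ N ∧
      c * N ≤ #((({p ∈ range (L + 1) | p.Prime} : Finset ℕ) ×ˢ primeFactorPairs N z).image
        fun x => 2 ^ x.1 + x.2.1 * x.2.2) := by
  obtain ⟨C, hC, hcoll⟩ := exists_sum_card_primeSolutions_le
  refine ⟨min (1 / 2048) (1 / (131072 * (8 * C))), by positivity, ?_⟩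
  have hlogtop : Tendsto (fun N : ℕ => Real.log (N : ℝ)) atTop atTop :=
    Real.tendsto_log_atTop.comp tendsto_natCast_atTop_atTop
  have hlogsqrt : ∀ᶠ N : ℕ in atTop, 32 * Real.log (N : ℝ) ≤ √(N : ℝ) := by
    have h1 := (isLittleO_log_rpow_atTop (show (0 : ℝ) < 1 / 2 by norm_num)).bound
      (show (0 : ℝ) < 1 / 32 by norm_num)
    filter_upwards [tendsto_natCast_atTop_atTop.eventually h1] with N hN
    rw [← Real.sqrt_eq_rpow, Real.norm_of_nonneg (Real.sqrt_nonneg _)] at hN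
    have := (Real.le_norm_self _).trans hN
    linarith
  -- The threshold 32 gives `log N / 4 ≥ 8`, hence `W ≥ 1`, and also `2 log N ≤ (log N / 4)²`, hence
  -- `log L ≤ 4 W`.
  filter_upwards [hlogtop.eventually_ge_atTop 32, hlogsqrt, eventually_ge_atTop 256]
    with N hlog32 hlogN hN256
  have hN0 : (0 : ℝ) < N := by exact_mod_cast (by omega : 0 < N)
  have hlog2 := Real.log_two_gt_d9
  have hlog2' := Real.log_two_lt_d9
  set L := Nat.log 2 N - 1 with hL
  set z := Nat.sqrt (Nat.sqrt N) with hz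
  have hlogN1 : 1 ≤ Nat.log 2 N := Nat.log_pos one_lt_two (by omega)
  have hL1 : 2 ^ (L + 1) ≤ N := by
    rw [hL, Nat.sub_add_cancel hlogN1]
    exact Nat.pow_log_le_self 2 (by omega)
  have hL2 : N < 2 ^ (L + 2) := by
    have : L + 2 = Nat.log 2 N + 1 := by omega
    rw [this]
    exact Nat.lt_pow_succ_log_self one_lt_two N
  have hz4 : z ^ 4 ≤ N := by
    calc z ^ 4 = (z ^ 2) ^ 2 := by ring
      _ ≤ (Nat.sqrt N) ^ 2 := Nat.pow_le_pow_left (Nat.sqrt_le' _) 2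
      _ ≤ N := Nat.sqrt_le' N
  have hz4' : N < (z + 1) ^ 4 := by
    calc N < (Nat.sqrt N + 1) ^ 2 := Nat.lt_succ_sqrt' N
      _ ≤ ((z + 1) ^ 2) ^ 2 := Nat.pow_le_pow_left (Nat.lt_succ_sqrt' _) 2
      _ = (z + 1) ^ 4 := by ring
  have hzge : 4 ≤ z := by
    rw [hz, Nat.le_sqrt, Nat.le_sqrt]
    omega
  have hLlog1 : ((L : ℝ) + 1) * Real.log 2 ≤ Real.log N := by
    have h1 : Real.log ((2 : ℝ) ^ (L + 1)) ≤ Real.log N :=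
      Real.log_le_log (by positivity) (by exact_mod_cast hL1)
    rw [Real.log_pow] at h1
    exact_mod_cast h1
  have hLlog2 : Real.log N ≤ ((L : ℝ) + 2) * Real.log 2 := by
    have h1 : Real.log N ≤ Real.log ((2 : ℝ) ^ (L + 2)) :=
      Real.log_le_log hN0 (by exact_mod_cast hL2.le)
    rw [Real.log_pow] at h1
    exact_mod_cast h1
  have hL30 : (30 : ℝ) ≤ L := by nlinarith
  have hL4 : 4 ≤ L := by
    have : 30 ≤ L := by exact_mod_cast hL30
    omega
  have hlogle : Real.log N ≤ 2 * L := by nlinarith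
  have hLle : (L : ℝ) ≤ 2 * Real.log N := by nlinarith
  have hlogL : 0 < Real.log (L : ℝ) := Real.log_pos (by linarith)
  refine ⟨L, z, hL1, ?_⟩
  set S : Finset ℕ := {p ∈ range (L + 1) | p.Prime} with hS
  set W := ∑ l ∈ range (z + 1) with l.Prime, (l : ℝ)⁻¹ with hW
  have hlogz : Real.log N / 4 ≤ Real.log ((z : ℝ) + 1) := by
    have h1 : Real.log N ≤ Real.log (((z : ℝ) + 1) ^ 4) :=
      Real.log_le_log hN0 (by exact_mod_cast hz4'.le)
    rw [Real.log_pow] at h1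
    push_cast at h1
    linarith
  have hWlow : Real.log (Real.log N / 4) / 2 ≤ W := by
    have h1 := half_log_log_le_sum_inv_primes (z := z) (by omega)
    have h2 := Real.log_le_log (by linarith) hlogz
    linarith
  have hW1 : 1 ≤ W := by
    have h1 : Real.log 8 ≤ Real.log (Real.log N / 4) :=
      Real.log_le_log (by norm_num) (by linarith)
    rw [show (8 : ℝ) = 2 ^ 3 by norm_num, Real.log_pow] at h1
    push_cast at h1
    linarith
  have hWL : Real.log L / 4 ≤ W := by
    have h1 : Real.log L ≤ Real.log ((Real.log N / 4) ^ 2) :=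
      Real.log_le_log (by linarith) (by nlinarith)
    rw [Real.log_pow] at h1
    push_cast at h1
    linarith
  have ht : 1 / 4 ≤ W / Real.log L := by
    rw [le_div_iff₀ hlogL]
    linarith
  refine min_mul_le_of_sq_le (M := (#(S ×ˢ primeFactorPairs N z) : ℝ)) hN0 (by positivity) ht ?_ ?_
  · have hSc : (L : ℝ) / (4 * Real.log L) ≤ #S := by
      have h1 := div_four_mul_log_le_primeCounting hL4
      rw [← Nat.primesLE_card_eq_primeCounting] at h1
      refine h1.trans (Nat.cast_le.2 (card_le_card fun p hp => ?_))
      rw [Nat.mem_primesLE] at hp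
      exact mem_filter.2 ⟨mem_range.2 (Nat.lt_succ_of_le hp.1), hp.2⟩
    have hQ := le_card_primeFactorPairs hz4 hzge hlogN
    rw [card_product]
    push_cast
    have hlogpos : 0 < Real.log (N : ℝ) := by linarith
    calc N * (W / Real.log L) / 256 ≤
          L / (4 * Real.log L) * (N / (32 * Real.log N) * W) := by
          rw [div_mul_eq_mul_div, mul_div_assoc', div_div, div_mul_eq_mul_div, mul_div_assoc',
            div_div, div_le_div_iff₀ (by positivity) (by positivity)]
          have : 0 ≤ N * W * Real.log L := by positivity
          nlinarith
      _ ≤ #S * #(primeFactorPairs N z) := by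
          gcongr
  · have h1 := card_sq_le_card_image_mul_card_collisions (S ×ˢ primeFactorPairs N z)
      (fun x => 2 ^ x.1 + x.2.1 * x.2.2)
    have h2 := card_collisions_le N z S
    have h3 := hcoll N z L (by omega) hz4
    have h4 := (Nat.cast_le (α := ℝ)).2 (h1.trans (Nat.mul_le_mul_left _ h2))
    rw [Nat.cast_mul, Nat.cast_add, Nat.cast_pow] at h4
    refine h4.trans (mul_le_mul_of_nonneg_left (add_le_add_right (h3.trans ?_) _)
      (Nat.cast_nonneg _))
    have hlogpos : 0 < Real.log (N : ℝ) := by linarith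
    -- Here `L ≤ 2 log N` and `W ≤ W²`; the factors 4 and 2 give `8 * C`.
    calc C * (N / Real.log N ^ 2) * (L / Real.log L) ^ 2 * (W ^ 2 + W)
        ≤ C * (N / Real.log N ^ 2) * (2 * Real.log N / Real.log L) ^ 2 * (2 * W ^ 2) := by
          gcongr
          nlinarith
      _ = 8 * C * N * (W / Real.log L) ^ 2 := by
          field_simp
          ring

theorem image_subset_sumset {N L z x : ℕ} (hL : 2 ^ (L + 1) ≤ N)
    (hx : x ∈ (({p ∈ range (L + 1) | p.Prime} : Finset ℕ) ×ˢ primeFactorPairs N z).image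
      fun x => 2 ^ x.1 + x.2.1 * x.2.2) :
    1 ≤ x ∧ x ≤ N ∧ ∃ p q : ℕ, p.Prime ∧ q ∈ primeOrProductOfTwoPrimes ∧ x = 2 ^ p + q := by
  obtain ⟨⟨p, l, q⟩, hy, rfl⟩ := mem_image.1 hx
  simp only [primeFactorPairs, mem_product, mem_filter, mem_range] at hy ⊢
  obtain ⟨⟨hp, hpp⟩, -, hl, hq, -, hlq⟩ := hy
  -- Both summands are at most `N / 2`: `2^p` since `2 ^ (L + 1) ≤ N`, and `l q` by the definition
  -- of `primeFactorPairs`.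
  have h1 : 2 ^ p ≤ 2 ^ L := Nat.pow_le_pow_right two_pos (by omega)
  have h2 : 0 < 2 ^ p := by positivity
  rw [pow_succ] at hL
  exact ⟨by omega, by omega, p, l * q, hpp, Or.inr ⟨l, q, hl, hq, rfl⟩, rfl⟩

theorem mainTheorem1 :
    HasPositiveLowerDensity
      {n : ℕ | ∃ p q : ℕ, p.Prime ∧ q ∈ primeOrProductOfTwoPrimes ∧ n = 2 ^ p + q} := by
  obtain ⟨c, hc, hev⟩ := exists_mul_le_card_image
  obtain ⟨N₀, hN₀⟩ := eventually_atTop.1 hev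
  -- One factor 2 pays for `⌊x⌋₊ ≥ x / 2`, the other makes the inequality strict.
  refine ⟨c / 4, by positivity, N₀ + 1, fun x hx => ?_⟩
  have hx1 : 1 ≤ x := by
    have : (0 : ℝ) ≤ N₀ := Nat.cast_nonneg _
    linarith
  obtain ⟨L, z, hL, hcard⟩ := hN₀ ⌊x⌋₊ (Nat.le_floor (by linarith))
  have hfloor : x / 2 ≤ ⌊x⌋₊ := by
    have h1 := Nat.lt_floor_add_one x
    have h2 : (1 : ℝ) ≤ ⌊x⌋₊ := by exact_mod_cast Nat.le_floor (by simpa using hx1)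
    linarith
  have hfin : {a : ℕ | 1 ≤ a ∧ (a : ℝ) ≤ x ∧ a ∈ {n : ℕ | ∃ p q : ℕ, p.Prime ∧
      q ∈ primeOrProductOfTwoPrimes ∧ n = 2 ^ p + q}}.Finite :=
    (Set.finite_Iic ⌊x⌋₊).subset fun a ha => Nat.le_floor ha.2.1
  have hle : #((({p ∈ range (L + 1) | p.Prime} : Finset ℕ) ×ˢ primeFactorPairs ⌊x⌋₊ z).image
      fun x => 2 ^ x.1 + x.2.1 * x.2.2) ≤ countingFunction {n : ℕ | ∃ p q : ℕ, p.Prime ∧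
      q ∈ primeOrProductOfTwoPrimes ∧ n = 2 ^ p + q} x := by
    rw [← Set.ncard_coe_finset]
    refine Set.ncard_le_ncard (fun a ha => ?_) hfin
    obtain ⟨h1, h2, h3⟩ := image_subset_sumset hL ha
    exact ⟨h1, (Nat.le_floor_iff (by linarith)).1 h2, h3⟩
  calc c / 4 * x < c * (x / 2) := by nlinarith
    _ ≤ c * ⌊x⌋₊ := by gcongr
    _ ≤ _ := hcard.trans (Nat.cast_le.2 hle)
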